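/- Let $0\le a\le b\le \tfrac12$, let $P_X=\mathrm{Bern}(a)$ and $P_Y=\mathrm{Bern}(b)$ on $\{0,1\}$, and let $c_n(x^n,y^n)=\frac1n\sum_{i=1}^n 1\{x_i\neq y_i\}$. For $\alpha\in\mathbb R$ let $$\mathcal G_\alpha(P_X^n,P_Y^n)=\inf\ \mathbb P\{c_n(X^n,Y^n)>\alpha\},$$ where the infimum is over all couplings of the product distributions $P_X^n$ and $P_Y^n$. For $p,q\in[0,1]$ let $D(p\|q)\in[0,\infty]$ be the relative entropy of $\mathrm{Bern}(p)$ with respect to $\mathrm{Bern}(q)$, and put $-\log 0=+\infty$. All arguments of $D$ below are restricted to $[0,1]$. 1. If $0\le\alpha<b-a$, then $$\lim_{n\to\infty}-\frac1n\log\bigl(1-\mathcal G_\alpha(P_X^n,P_Y^n)\bigr)=\min_{a'}\max\{D(a'+\alpha\|b),\,D(a'\|a)\},$$ where the minimum, over $a'$ with $a',a'+\alpha\in[0,1]$, is attained. If moreover $a>0$, this value equals $D(a^*\|a)$, where $a^*$ is the unique solution in $[a,b-\alpha]$ of the equation $D(a'+\alpha\|b)=D(a'\|a)$ in $a'$. 2.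 If $a>0$ and $\alpha>b-a$, then $$\lim_{n\to\infty}-\frac1n\log\mathcal G_\alpha(P_X^n,P_Y^n)=\min\{D(a^*\|a),\,D(b^*\|b)\}$$ in $[0,\infty]$, where $a^*$ is the maximum of the solutions $a'\le b-\alpha$ of $D(a'+\alpha\|b)=D(a'\|a)$ (with $D(a^*\|a):=+\infty$ if there is no such solution), and $b^*$ is the minimum of the solutions $b'\ge a+\alpha$ of $D(b'\|b)=D(b'-\alpha\|a)$ (with $D(b^*\|b):=+\infty$ if there is no such solution). The maximum and the minimum exist whenever solutions exist. -/

import Mathlib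

open MeasureTheory ProbabilityTheory Filter Topology
open scoped ENNReal

noncomputable section

namespace BinaryOT

/-- The couplings of `μ` and `ν`: the measures on the product with these two marginals. -/
def couplings {X Y : Type*} [MeasurableSpace X] [MeasurableSpace Y]
    (μ : Measure X) (ν : Measure Y) : Set (Measure (X × Y)) :=
  {π | π.map Prod.fst = μ ∧ π.map Prod.snd = ν}

/-- The optimal excess-cost probability (the value of Strassen's optimal transport problem) for
the cost `c`: the infimum over all couplings of the probability that the cost exceeds `α`. -/
def optECP {X Y : Type*} [MeasurableSpace X] [MeasurableSpace Y]
    (c : X → Y → ℝ) (α : ℝ) (μ : Measure X) (ν : Measure Y) : ℝ≥0∞ :=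
  ⨅ π ∈ couplings μ ν, π {p | α < c p.1 p.2}

/-- The additive cost `cₙ(xⁿ, yⁿ) = (1/n) ∑ c(xᵢ, yᵢ)` on sequences of length `n`. -/
def avgCost {X Y : Type*} (c : X → Y → ℝ) (n : ℕ) (x : Fin n → X) (y : Fin n → Y) : ℝ :=
  (1 / (n : ℝ)) * ∑ i, c (x i) (y i)

/-- The Hamming cost `1{x ≠ y}` on the binary alphabet. -/
def hamming (x y : Fin 2) : ℝ := if x = y then 0 else 1

/-- The distribution `Bern(p)` on `{0, 1}`, with mass `p` at `1` and `1 - p` at `0`.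
It is meant for `0 ≤ p ≤ 1` (other values of `p` are projected to this interval). -/
def bern (p : ℝ) : Measure (Fin 2) :=
  bernoulliMeasure 1 0 (Set.projIcc 0 1 zero_le_one p)

/-- The binary relative entropy `D(p‖q) = D(Bern(p)‖Bern(q))`, for `p, q ∈ [0, 1]`. -/
def binKL (p q : ℝ) : ℝ≥0∞ := InformationTheory.klDiv (bern p) (bern q)

/-- `𝒢_α(P_Xⁿ, P_Yⁿ)` for `P_X = Bern(a)`, `P_Y = Bern(b)` and the Hamming cost. -/
def G (a b α : ℝ) (n : ℕ) : ℝ≥0∞ :=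
  optECP (avgCost hamming n) α
    (Measure.pi fun _ : Fin n => bern a) (Measure.pi fun _ : Fin n => bern b)

/-- `-(1/n) log x` as an extended real number (so it is `+∞` for `x = 0` and `n ≥ 1`). -/
def rate (n : ℕ) (x : ℝ≥0∞) : EReal := ((-(1 / (n : ℝ)) : ℝ) : EReal) * ENNReal.log x

/-- The solutions `a'` of `D(a'+α‖b) = D(a'‖a)` with `a' ≤ b - α`. -/
def solsA (a b α : ℝ) : Set ℝ :=
  {x | x ∈ Set.Icc 0 1 ∧ x + α ∈ Set.Icc 0 1 ∧ x ≤ b - α ∧ binKL (x + α) b = binKL x a}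

/-- The solutions `b'` of `D(b'‖b) = D(b'-α‖a)` with `b' ≥ a + α`. -/
def solsB (a b α : ℝ) : Set ℝ :=
  {x | x ∈ Set.Icc 0 1 ∧ x - α ∈ Set.Icc 0 1 ∧ a + α ≤ x ∧ binKL x b = binKL (x - α) a}

end BinaryOT

end

noncomputable section

namespace BinaryOT

/-! ### The binary relative entropy as a real function -/

/-- The binary relative entropy of `p ∈ [0, 1]` with respect to `q ∈ (0, 1)`. -/
def kl (p q : ℝ) : ℝ := -Real.binEntropy p - p * Real.log q - (1 - p) * Real.log (1 - q)

lemma continuous_kl (q : ℝ) : Continuous fun p => kl p q := by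
  unfold kl
  fun_prop

lemma kl_one_sub (p q : ℝ) : kl (1 - p) (1 - q) = kl p q := by
  simp only [kl, Real.binEntropy_one_sub, sub_sub_cancel]
  ring

lemma kl_self (q : ℝ) : kl q q = 0 := by
  simp only [kl, Real.binEntropy, Real.log_inv]
  ring

lemma hasDerivAt_kl {p : ℝ} (q : ℝ) (h0 : p ≠ 0) (h1 : p ≠ 1) :
    HasDerivAt (fun p => kl p q)
      (Real.log p - Real.log (1 - p) - (Real.log q - Real.log (1 - q))) p := by
  have h := (((Real.hasDerivAt_binEntropy h0 h1).neg).sub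
    ((hasDerivAt_id p).mul_const (Real.log q))).sub
    (((hasDerivAt_const p (1 : ℝ)).sub (hasDerivAt_id p)).mul_const (Real.log (1 - q)))
  exact h.congr_deriv (by ring)

lemma kl_strictMonoOn {q : ℝ} (hq : q ∈ Set.Ioo (0 : ℝ) 1) :
    StrictMonoOn (fun p => kl p q) (Set.Icc q 1) := by
  refine strictMonoOn_of_deriv_pos (convex_Icc _ _) (continuous_kl q).continuousOn fun x hx => ?_
  rw [interior_Icc] at hx
  have hx0 : 0 < x := hq.1.trans hx.1
  rw [(hasDerivAt_kl q hx0.ne' hx.2.ne).deriv]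
  have h1 := Real.log_lt_log hq.1 hx.1
  have h2 := Real.log_lt_log (sub_pos.2 hx.2) (sub_lt_sub_left hx.1 1)
  linarith

lemma kl_strictAntiOn {q : ℝ} (hq : q ∈ Set.Ioo (0 : ℝ) 1) :
    StrictAntiOn (fun p => kl p q) (Set.Icc 0 q) := by
  intro x hx y hy hxy
  have h := kl_strictMonoOn (q := 1 - q) ⟨by linarith [hq.2], by linarith [hq.1]⟩
    (a := 1 - y) ⟨by linarith [hy.2], by linarith [hy.1]⟩
    (b := 1 - x) ⟨by linarith [hx.2], by linarith [hx.1]⟩ (by linarith)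
  simpa only [kl_one_sub] using h

lemma kl_pos {p q : ℝ} (hq : q ∈ Set.Ioo (0 : ℝ) 1) (hp : p ∈ Set.Icc (0 : ℝ) 1) (hne : p ≠ q) :
    0 < kl p q := by
  rcases lt_or_gt_of_ne hne with h | h
  · have := kl_strictAntiOn hq ⟨hp.1, h.le⟩ ⟨hq.1.le, le_rfl⟩ h
    simpa only [kl_self] using this
  · have := kl_strictMonoOn hq ⟨le_rfl, hq.2.le⟩ ⟨h.le, hp.2⟩ h
    simpa only [kl_self] using this

lemma kl_nonneg {p q : ℝ} (hq : q ∈ Set.Ioo (0 : ℝ) 1) (hp : p ∈ Set.Icc (0 : ℝ) 1) :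
    0 ≤ kl p q := by
  by_cases h : p = q
  · rw [h, kl_self]
  · exact (kl_pos hq hp h).le

/-! ### Bernoulli measures -/

instance (p : ℝ) : IsProbabilityMeasure (bern p) := by
  unfold bern; infer_instance

lemma bern_one {p : ℝ} (hp : p ∈ Set.Icc (0 : ℝ) 1) : bern p {1} = ENNReal.ofReal p := by
  rw [bern, Set.projIcc_of_mem _ hp]
  rw [bernoulliMeasure_apply_of_mem_of_notMem _ (by simp) (by simp) (by simp)]
  rw [ENNReal.ofReal, Real.toNNReal_of_nonneg hp.1]
  rfl

lemma bern_zero {p : ℝ} (hp : p ∈ Set.Icc (0 : ℝ) 1) : bern p {0} = ENNReal.ofReal (1 - p) := by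
  rw [bern, Set.projIcc_of_mem _ hp]
  rw [bernoulliMeasure_apply_of_notMem_of_mem _ (by simp) (by simp) (by simp)]
  rw [ENNReal.ofReal, Real.toNNReal_of_nonneg (by linarith [hp.2])]
  rfl

lemma binKL_self (p : ℝ) : binKL p p = 0 := InformationTheory.klDiv_self _

lemma binKL_zero_right {p : ℝ} (h0 : 0 < p) (h1 : p ≤ 1) : binKL p 0 = ∞ := by
  refine InformationTheory.klDiv_of_not_ac fun h => ?_
  have h2 : bern 0 {1} = 0 := by rw [bern_one (by simp)]; simp
  have h3 := h h2
  rw [bern_one ⟨h0.le, h1⟩, ENNReal.ofReal_eq_zero] at h3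
  linarith

lemma binKL_eq {p q : ℝ} (hq : q ∈ Set.Ioo (0 : ℝ) 1) (hp : p ∈ Set.Icc (0 : ℝ) 1) :
    binKL p q = ENNReal.ofReal (kl p q) := by
  have hq' : q ∈ Set.Icc (0 : ℝ) 1 := ⟨hq.1.le, hq.2.le⟩
  have h1q : 0 < 1 - q := sub_pos.2 hq.2
  set g : Fin 2 → ℝ≥0∞ := ![ENNReal.ofReal ((1 - p) / (1 - q)), ENNReal.ofReal (p / q)] with hg
  have hgm : Measurable g := .of_discrete
  have hd : bern p = (bern q).withDensity g := by
    refine Measure.ext_of_singleton fun i => ?_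
    rw [withDensity_apply _ (measurableSet_singleton i), lintegral_singleton]
    fin_cases i
    · simp only [hg, Fin.zero_eta, Matrix.cons_val_zero]
      rw [bern_zero hp, bern_zero hq',
        ← ENNReal.ofReal_mul (div_nonneg (by linarith [hp.2]) h1q.le),
        div_mul_cancel₀ _ h1q.ne']
    · simp only [hg, Fin.mk_one, Matrix.cons_val_one, Matrix.cons_val_fin_one]
      rw [bern_one hp, bern_one hq', ← ENNReal.ofReal_mul (div_nonneg hp.1 hq.1.le),
        div_mul_cancel₀ _ hq.1.ne']
  have hac : bern p ≪ bern q := by rw [hd]; exact withDensity_absolutelyContinuous _ _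
  have hrn : (bern p).rnDeriv (bern q) =ᵐ[bern q] g := by
    rw [hd]; exact Measure.rnDeriv_withDensity _ hgm
  rw [binKL, InformationTheory.klDiv_eq_lintegral_klFun_of_ac hac,
    lintegral_congr_ae (g := fun x => ENNReal.ofReal (InformationTheory.klFun (g x).toReal))
      (hrn.mono fun x hx => by simp only [hx]), lintegral_fintype]
  simp only [Fin.sum_univ_two, hg, Matrix.cons_val_zero, Matrix.cons_val_one,
    Matrix.cons_val_fin_one]
  have e0 : 0 ≤ (1 - p) / (1 - q) := div_nonneg (by linarith [hp.2]) h1q.le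
  have e1 : 0 ≤ p / q := div_nonneg hp.1 hq.1.le
  rw [ENNReal.toReal_ofReal e0, ENNReal.toReal_ofReal e1, bern_zero hq', bern_one hq',
    ← ENNReal.ofReal_mul (InformationTheory.klFun_nonneg e0),
    ← ENNReal.ofReal_mul (InformationTheory.klFun_nonneg e1),
    ← ENNReal.ofReal_add (mul_nonneg (InformationTheory.klFun_nonneg e0) h1q.le)
      (mul_nonneg (InformationTheory.klFun_nonneg e1) hq.1.le)]
  congr 1
  have key : ∀ x y : ℝ, 0 ≤ x → 0 < y →
      InformationTheory.klFun (x / y) * y = x * Real.log x - x * Real.log y + y - x := by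
    intro x y hx hy
    rw [InformationTheory.klFun]
    rcases hx.eq_or_lt with rfl | hx
    · simp
    · rw [Real.log_div hx.ne' hy.ne']
      field_simp
  rw [key _ _ (by linarith [hp.2]) h1q, key _ _ hp.1 hq.1, kl, Real.binEntropy, Real.log_inv,
    Real.log_inv]
  ring

/-! ### The difference of two shifted relative entropies -/

/-- The difference `D(u+α‖b) - D(u‖a)`. -/
def klGap (a b α u : ℝ) : ℝ := kl (u + α) b - kl u a

lemma continuous_klGap (a b α : ℝ) : Continuous (klGap a b α) :=
  ((continuous_kl b).comp (continuous_id.add continuous_const)).sub (continuous_kl a)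

lemma hasDerivAt_klGap (a b : ℝ) {α u : ℝ} (hα : 0 ≤ α) (hu0 : 0 < u) (hu1 : u + α < 1) :
    HasDerivAt (klGap a b α) (Real.log (1 + α / (u * (1 - u - α))) -
      (Real.log b - Real.log (1 - b) - (Real.log a - Real.log (1 - a)))) u := by
  have h1 := (hasDerivAt_kl b (p := u + α) (by linarith) hu1.ne).comp u
    ((hasDerivAt_id u).add_const α)
  have h2 := h1.sub (hasDerivAt_kl a hu0.ne' (by linarith : u ≠ 1))
  refine h2.congr_deriv ?_
  have h3 : 0 < 1 - u - α := by linarith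
  have e : 1 + α / (u * (1 - u - α)) = ((u + α) * (1 - u)) / (u * (1 - u - α)) := by
    field_simp
    ring
  rw [e, Real.log_div (mul_pos (by linarith) (by linarith)).ne' (mul_pos hu0 h3).ne',
    Real.log_mul (by linarith) (by linarith), Real.log_mul hu0.ne' h3.ne',
    show 1 - (u + α) = 1 - u - α by ring]
  ring

/-- Shifting both arguments to the right towards `1 / 2` decreases the relative entropy
of deviations to the left. -/
lemma kl_add_sub_le {a b t : ℝ} (ha : 0 < a) (hab : a ≤ b) (hb : b ≤ 1 / 2)
    (ht : t ∈ Set.Icc 0 a) : kl (t + (b - a)) b ≤ kl t a := by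
  have hmono : MonotoneOn (klGap a b (b - a)) (Set.Icc 0 a) := by
    refine monotoneOn_of_deriv_nonneg (convex_Icc _ _) (continuous_klGap _ _ _).continuousOn
      (fun x hx => ?_) fun x hx => ?_ <;> rw [interior_Icc] at hx <;>
      have hd := hasDerivAt_klGap a b (α := b - a) (by linarith) hx.1 (by linarith [hx.2])
    · exact hd.differentiableAt.differentiableWithinAt
    · rw [hd.deriv]
      have hx0 := hx.1
      have hxa := hx.2
      have e : Real.log b - Real.log (1 - b) - (Real.log a - Real.log (1 - a)) =
          Real.log (1 + (b - a) / (a * (1 - a - (b - a)))) := by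
        have e1 : 1 + (b - a) / (a * (1 - a - (b - a))) = (b * (1 - a)) / (a * (1 - b)) := by
          have : (1 - a - (b - a)) = 1 - b := by ring
          rw [this]
          have : 1 - b ≠ 0 := by linarith
          field_simp
          ring
        rw [e1, Real.log_div (mul_pos (by linarith) (by linarith)).ne'
          (mul_pos ha (by linarith)).ne', Real.log_mul (by linarith) (by linarith),
          Real.log_mul (by linarith) (by linarith)]
        ring
      rw [e, sub_nonneg]
      have hp : 0 < x * (1 - x - (b - a)) := mul_pos hx0 (by linarith)
      have hle : x * (1 - x - (b - a)) ≤ a * (1 - a - (b - a)) := by nlinarith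
      refine Real.log_le_log ?_ ?_
      · have : 0 ≤ (b - a) / (a * (1 - a - (b - a))) :=
          div_nonneg (by linarith) (hp.le.trans hle)
        linarith
      · have := div_le_div_of_nonneg_left (sub_nonneg.2 hab) hp hle
        linarith
  have h := hmono ht ⟨ha.le, le_rfl⟩ ht.2
  have e : klGap a b (b - a) a = 0 := by
    simp only [klGap, add_sub_cancel, kl_self, sub_zero]
  rw [e, klGap] at h
  linarith

/-- On the left of `a`, the shifted deviations have strictly smaller relative entropy. -/
lemma klGap_neg {a b α t : ℝ} (ha : 0 < a) (hab : a ≤ b) (hb : b ≤ 1 / 2) (hα : b - a < α)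
    (ht : 0 ≤ t) (ht' : t ≤ b - α) : klGap a b α t < 0 := by
  have h1 := kl_add_sub_le ha hab hb (t := t) ⟨ht, by linarith⟩
  have h2 := kl_strictAntiOn (q := b) ⟨by linarith, by linarith⟩ (a := t + (b - a))
    ⟨by linarith, by linarith⟩ (b := t + α) ⟨by linarith, by linarith⟩ (by linarith)
  simp only at h2
  rw [klGap]
  linarith

/-- The first zero of the gap is not at the right end point. -/
lemma lt_of_klGap_eq_zero {a b α u : ℝ} (hα : 0 < α)
    (hau : 0 < a) (hu : u ∈ Set.Ioc a (1 - α)) (h0 : klGap a b α u = 0)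
    (hpos : ∀ t ∈ Set.Ico a u, 0 < klGap a b α t) : u < 1 - α := by
  refine lt_of_le_of_ne hu.2 fun he => ?_
  have hu0 : 0 < u := hau.trans hu.1
  set C := Real.log b - Real.log (1 - b) - (Real.log a - Real.log (1 - a)) with hC
  set s := max ((a + u) / 2) (u - α / Real.exp C) with hs
  have hsu : s < u := max_lt (by linarith [hu.1]) (by linarith [div_pos hα (Real.exp_pos C)])
  have hsa : a < s := lt_max_of_lt_left (by linarith [hu.1])
  have hmono : StrictMonoOn (klGap a b α) (Set.Icc s u) := by
    refine strictMonoOn_of_deriv_pos (convex_Icc _ _) (continuous_klGap _ _ _).continuousOn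
      fun x hx => ?_
    rw [interior_Icc] at hx
    have hx0 : 0 < x := by linarith [hx.1]
    rw [(hasDerivAt_klGap a b hα.le hx0 (by linarith [hx.2])).deriv, sub_pos,
      Real.lt_log_iff_exp_lt]
    · have h1 : u - x < α / Real.exp C := by
        have := le_max_right ((a + u) / 2) (u - α / Real.exp C)
        linarith [hx.1]
      have h2 : 0 < 1 - x - α := by linarith [hx.2]
      have h3 : x * (1 - x - α) < α / Real.exp C := by nlinarith
      have h4 : Real.exp C < α / (x * (1 - x - α)) := by
        rw [lt_div_iff₀ (Real.exp_pos _)] at h3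
        rw [lt_div_iff₀ (mul_pos hx0 h2)]
        linarith
      linarith
    · have : 0 ≤ α / (x * (1 - x - α)) :=
        div_nonneg hα.le (mul_nonneg hx0.le (by linarith [hx.2]))
      linarith
  have := hmono ⟨le_rfl, hsu.le⟩ ⟨hsu.le, le_rfl⟩ hsu
  have := hpos s ⟨hsa.le, hsu⟩
  linarith

/-- At its first zero, the gap either becomes negative or has a critical point, which
is then in the right half of the interval. -/
lemma klGap_crossing_or_tangent {a b α u : ℝ} (hα : 0 < α)
    (hau : 0 < a) (hu : u ∈ Set.Ioo a (1 - α)) (h0 : klGap a b α u = 0)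
    (hpos : ∀ t ∈ Set.Ico a u, 0 < klGap a b α t) :
    (∀ δ > 0, ∃ t ∈ Set.Ioo u (u + δ), klGap a b α t < 0) ∨
      (HasDerivAt (klGap a b α) 0 u ∧ 1 - α < 2 * u) := by
  refine or_iff_not_imp_left.2 fun h => ?_
  push Not at h
  obtain ⟨δ, hδ, h⟩ := h
  have hu0 : 0 < u := hau.trans hu.1
  have hd := hasDerivAt_klGap a b hα.le hu0 (by linarith [hu.2])
  have hmin : IsLocalMin (klGap a b α) u := by
    filter_upwards [Ioo_mem_nhds hu.1 (by linarith : u < u + δ)] with t ht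
    rw [h0]
    rcases lt_trichotomy t u with h1 | rfl | h1
    · exact (hpos t ⟨ht.1.le, h1⟩).le
    · exact h0.ge
    · exact h t ⟨h1, ht.2⟩
  have hz := hmin.hasDerivAt_eq_zero hd
  refine ⟨by rwa [hz] at hd, ?_⟩
  by_contra hlt
  push Not at hlt
  have hmono : StrictMonoOn (klGap a b α) (Set.Icc a u) := by
    refine strictMonoOn_of_deriv_pos (convex_Icc _ _) (continuous_klGap _ _ _).continuousOn
      fun x hx => ?_
    rw [interior_Icc] at hx
    have hx0 : 0 < x := hau.trans hx.1
    have hxu := hx.2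
    have hu2 := hu.2
    rw [(hasDerivAt_klGap a b hα.le hx0 (by linarith)).deriv, ← hz, sub_lt_sub_iff_right]
    have h1 : 0 < x * (1 - x - α) := mul_pos hx0 (by linarith)
    have h2 : x * (1 - x - α) < u * (1 - u - α) := by nlinarith
    have h3 : 0 < α / (u * (1 - u - α)) := div_pos hα (h1.trans h2)
    have h4 := div_lt_div_of_pos_left hα h1 h2
    exact Real.log_lt_log (by linarith) (by linarith)
  have := hmono ⟨le_rfl, hu.1.le⟩ ⟨hu.1.le, le_rfl⟩ hu.1
  have := hpos a ⟨le_rfl, hu.1⟩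
  linarith

/-! ### Binomial probabilities -/

/-- The probability that a binomial random variable with parameters `n`, `p` equals `k`. -/
def bin (n : ℕ) (p : ℝ) (k : ℕ) : ℝ := n.choose k * p ^ k * (1 - p) ^ (n - k)

/-- The probability that a binomial random variable with parameters `n`, `p` is at least `k`. -/
def tail (n : ℕ) (p : ℝ) (k : ℕ) : ℝ := ∑ j ∈ Finset.Ico k (n + 1), bin n p j

lemma bin_nonneg {p : ℝ} (hp : p ∈ Set.Icc (0 : ℝ) 1) (n k : ℕ) : 0 ≤ bin n p k :=
  mul_nonneg (mul_nonneg (Nat.cast_nonneg _) (pow_nonneg hp.1 _))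
    (pow_nonneg (sub_nonneg.2 hp.2) _)

lemma sum_bin (n : ℕ) (p : ℝ) : ∑ k ∈ Finset.range (n + 1), bin n p k = 1 := by
  have h := add_pow p (1 - p) n
  rw [add_sub_cancel, one_pow] at h
  rw [h]
  exact Finset.sum_congr rfl fun k _ => by rw [bin]; ring

lemma sum_range_bin_add_tail {n k : ℕ} (p : ℝ) (hk : k ≤ n + 1) :
    ∑ j ∈ Finset.range k, bin n p j + tail n p k = 1 := by
  rw [tail, Finset.sum_range_add_sum_Ico _ hk, sum_bin]

lemma tail_zero (n : ℕ) (p : ℝ) : tail n p 0 = 1 := by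
  rw [tail, ← Finset.range_eq_Ico, sum_bin]

lemma tail_eq_zero {n k : ℕ} (p : ℝ) (hk : n < k) : tail n p k = 0 := by
  rw [tail, Finset.Ico_eq_empty (by omega), Finset.sum_empty]

lemma tail_nonneg {p : ℝ} (hp : p ∈ Set.Icc (0 : ℝ) 1) (n k : ℕ) : 0 ≤ tail n p k :=
  Finset.sum_nonneg fun j _ => bin_nonneg hp n j

lemma tail_anti {p : ℝ} (hp : p ∈ Set.Icc (0 : ℝ) 1) (n : ℕ) {k l : ℕ} (h : k ≤ l) :
    tail n p l ≤ tail n p k :=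
  Finset.sum_le_sum_of_subset_of_nonneg (Finset.Ico_subset_Ico_left h)
    fun j _ _ => bin_nonneg hp n j

lemma tail_eq_add {n k : ℕ} (p : ℝ) (hk : k ≤ n) : tail n p k = bin n p k + tail n p (k + 1) := by
  rw [tail, Finset.sum_eq_sum_Ico_succ_bot (by omega), tail]

lemma bin_le_tail {p : ℝ} (hp : p ∈ Set.Icc (0 : ℝ) 1) {n k j : ℕ} (hk : k ≤ j) (hj : j ≤ n) :
    bin n p j ≤ tail n p k :=
  Finset.single_le_sum (fun i _ => bin_nonneg hp n i) (Finset.mem_Ico.2 ⟨hk, by omega⟩)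

lemma bin_zero_zero (n : ℕ) : bin n 0 0 = 1 := by simp [bin]

lemma tail_zero_succ (n k : ℕ) : tail n 0 (k + 1) = 0 :=
  Finset.sum_eq_zero fun j hj => by
    have : j ≠ 0 := by have := (Finset.mem_Ico.1 hj).1; omega
    simp [bin, this]

lemma bin_succ_succ (n k : ℕ) (p : ℝ) :
    bin (n + 1) p (k + 1) = p * bin n p k + (1 - p) * bin n p (k + 1) := by
  rw [bin, bin, bin, Nat.choose_succ_succ, Nat.add_sub_add_right]
  rcases lt_or_ge k n with h | h
  · obtain ⟨m, rfl⟩ := Nat.exists_eq_add_of_lt h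
    rw [show k + m + 1 - k = m + 1 by omega, show k + m + 1 - (k + 1) = m by omega]
    push_cast
    ring
  · rw [Nat.choose_eq_zero_of_lt (by omega : n < k + 1)]
    push_cast
    ring

lemma bin_eq_zero {n k : ℕ} (p : ℝ) (h : n < k) : bin n p k = 0 := by
  rw [bin, Nat.choose_eq_zero_of_lt h]; simp

lemma tail_succ_succ (n k : ℕ) (p : ℝ) :
    tail (n + 1) p (k + 1) = p * tail n p k + (1 - p) * tail n p (k + 1) := by
  have e : tail n p (k + 1) = ∑ j ∈ Finset.Ico k (n + 1), bin n p (j + 1) := by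
    rw [Finset.sum_Ico_add' (fun j => bin n p j)]
    refine Finset.sum_subset (Finset.Ico_subset_Ico_right (by omega)) fun j hj hj' => ?_
    rw [Finset.mem_Ico] at hj hj'
    exact bin_eq_zero p (by omega)
  rw [e, tail, tail, ← Finset.sum_Ico_add' (fun j => bin (n + 1) p j), Finset.mul_sum,
    Finset.mul_sum, ← Finset.sum_add_distrib]
  exact Finset.sum_congr rfl fun j _ => bin_succ_succ n j p

/-- Binomial distributions are stochastically monotone in the success probability. -/
lemma tail_mono {a b : ℝ} (ha : 0 ≤ a) (hab : a ≤ b) (hb : b ≤ 1) (n k : ℕ) :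
    tail n a k ≤ tail n b k := by
  induction n generalizing k with
  | zero =>
    rcases k with _ | k
    · rw [tail_zero, tail_zero]
    · rw [tail_eq_zero _ (by omega), tail_eq_zero _ (by omega)]
  | succ n ih =>
    rcases k with _ | k
    · rw [tail_zero, tail_zero]
    · rw [tail_succ_succ, tail_succ_succ]
      have h1 := ih k
      have h2 := ih (k + 1)
      have h3 := tail_anti (p := b) ⟨ha.trans hab, hb⟩ n (Nat.le_succ k)
      nlinarith

/-! ### Chernoff bounds -/

lemma bin_le_mul_exp {p s : ℝ} (hp : p ∈ Set.Ioo (0 : ℝ) 1) (hs : s ∈ Set.Ioo (0 : ℝ) 1)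
    {n j : ℕ} (hj : j ≤ n) (h : 0 ≤ (j - s * n) * (s - p)) :
    bin n p j ≤ bin n s j * Real.exp (-(n * kl s p)) := by
  have hp1 : 0 < 1 - p := sub_pos.2 hp.2
  have hs1 : 0 < 1 - s := sub_pos.2 hs.2
  have e : bin n p j = bin n s j * Real.exp (j * Real.log (p / s) +
      ((n - j : ℕ) : ℝ) * Real.log ((1 - p) / (1 - s))) := by
    rw [Real.exp_add, Real.exp_nat_mul, Real.exp_nat_mul, Real.exp_log (div_pos hp.1 hs.1),
      Real.exp_log (div_pos hp1 hs1), div_pow, div_pow, bin, bin]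
    have := hs.1.ne'
    field_simp
  rw [e]
  refine mul_le_mul_of_nonneg_left (Real.exp_le_exp.2 ?_) (bin_nonneg ⟨hs.1.le, hs.2.le⟩ n j)
  have e2 : kl s p = -(s * Real.log (p / s) + (1 - s) * Real.log ((1 - p) / (1 - s))) := by
    rw [kl, Real.binEntropy, Real.log_inv, Real.log_inv, Real.log_div hp.1.ne' hs.1.ne',
      Real.log_div hp1.ne' hs1.ne']
    ring
  rw [e2, Nat.cast_sub hj]
  have h3 : (j - s * n) * (Real.log (p / s) - Real.log ((1 - p) / (1 - s))) ≤ 0 := by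
    rw [Real.log_div hp.1.ne' hs.1.ne', Real.log_div hp1.ne' hs1.ne']
    rcases lt_trichotomy s p with hsp | hsp | hsp
    · have h4 := Real.log_le_log hs.1 hsp.le
      have h5 := Real.log_le_log hp1 (sub_le_sub_left hsp.le 1)
      have h6 : (j - s * n : ℝ) ≤ 0 := by nlinarith
      exact mul_nonpos_of_nonpos_of_nonneg h6 (by linarith)
    · rw [hsp]; simp
    · have h4 := Real.log_le_log hp.1 hsp.le
      have h5 := Real.log_le_log hs1 (sub_le_sub_left hsp.le 1)
      have h6 : 0 ≤ (j - s * n : ℝ) := by nlinarith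
      exact mul_nonpos_of_nonneg_of_nonpos h6 (by linarith)
  linarith

lemma sum_bin_le_exp {p s : ℝ} (hp : p ∈ Set.Ioo (0 : ℝ) 1) (hs : s ∈ Set.Icc (0 : ℝ) 1)
    {n : ℕ} (S : Finset ℕ) (hS : S ⊆ Finset.range (n + 1))
    (h : ∀ j ∈ S, 0 ≤ (j - s * n) * (s - p)) :
    ∑ j ∈ S, bin n p j ≤ Real.exp (-(n * kl s p)) := by
  rcases hs.1.eq_or_lt with rfl | hs0
  · have hS' : S ⊆ {0} := fun j hj => by
      have h1 := h j hj
      have h2 : (j : ℝ) ≤ 0 := by nlinarith [hp.1]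
      simpa using h2
    refine (Finset.sum_le_sum_of_subset_of_nonneg hS'
      fun j _ _ => bin_nonneg ⟨hp.1.le, hp.2.le⟩ n j).trans_eq ?_
    rw [Finset.sum_singleton]
    simp [bin, kl, Real.exp_nat_mul, Real.exp_log (sub_pos.2 hp.2)]
  rcases hs.2.eq_or_lt with rfl | hs1
  · have hS' : S ⊆ {n} := fun j hj => by
      have h1 := h j hj
      have h2 : (n : ℝ) ≤ j := by nlinarith [hp.2]
      have h3 := Finset.mem_range.1 (hS hj)
      rw [Finset.mem_singleton]
      have : n ≤ j := by exact_mod_cast h2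
      omega
    refine (Finset.sum_le_sum_of_subset_of_nonneg hS'
      fun j _ _ => bin_nonneg ⟨hp.1.le, hp.2.le⟩ n j).trans_eq ?_
    rw [Finset.sum_singleton]
    simp [bin, kl, Real.exp_nat_mul, Real.exp_log hp.1]
  calc ∑ j ∈ S, bin n p j ≤ ∑ j ∈ S, bin n s j * Real.exp (-(n * kl s p)) :=
        Finset.sum_le_sum fun j hj => bin_le_mul_exp hp ⟨hs0, hs1⟩
          (by have := Finset.mem_range.1 (hS hj); omega) (h j hj)
    _ = (∑ j ∈ S, bin n s j) * Real.exp (-(n * kl s p)) := by rw [Finset.sum_mul]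
    _ ≤ 1 * Real.exp (-(n * kl s p)) := by
        refine mul_le_mul_of_nonneg_right ?_ (Real.exp_pos _).le
        rw [← sum_bin n s]
        exact Finset.sum_le_sum_of_subset_of_nonneg hS fun j _ _ => bin_nonneg hs n j
    _ = _ := one_mul _

lemma tail_le_exp {p s : ℝ} (hp : p ∈ Set.Ioo (0 : ℝ) 1) (hs : s ∈ Set.Icc p 1) {n k : ℕ}
    (hk : s * n ≤ k) : tail n p k ≤ Real.exp (-(n * kl s p)) := by
  refine sum_bin_le_exp hp ⟨hp.1.le.trans hs.1, hs.2⟩ _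
    (fun j hj => Finset.mem_range.2 (Finset.mem_Ico.1 hj).2) fun j hj => ?_
  have : (k : ℝ) ≤ j := by exact_mod_cast (Finset.mem_Ico.1 hj).1
  exact mul_nonneg (by linarith) (sub_nonneg.2 hs.1)

lemma sum_range_bin_le_exp {p s : ℝ} (hp : p ∈ Set.Ioo (0 : ℝ) 1) (hs : s ∈ Set.Icc 0 p)
    {n k : ℕ} (hk : k ≤ n + 1) (hks : k ≤ s * n + 1) :
    ∑ j ∈ Finset.range k, bin n p j ≤ Real.exp (-(n * kl s p)) := by
  refine sum_bin_le_exp hp ⟨hs.1, hs.2.trans hp.2.le⟩ _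
    (Finset.range_subset_range.2 hk) fun j hj => ?_
  have : (j : ℝ) + 1 ≤ k := by exact_mod_cast Finset.mem_range.1 hj
  exact mul_nonneg_of_nonpos_of_nonpos (by linarith) (sub_nonpos.2 hs.2)

/-! ### Lower bounds from Stirling's formula -/

/-- The probability that a binomial random variable with parameters `n`, `k / n` equals `k`. -/
def pre (n k : ℕ) : ℝ := bin n (k / n) k

lemma bin_eq_pre_mul_exp {q : ℝ} (hq : q ∈ Set.Ioo (0 : ℝ) 1) {n k : ℕ} (hn : 0 < n)
    (hk : k ≤ n) : bin n q k = pre n k * Real.exp (-(n * kl (k / n) q)) := by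
  have hn' : (0 : ℝ) < n := Nat.cast_pos.2 hn
  have hq1 : 0 < 1 - q := sub_pos.2 hq.2
  have hpow : ∀ (m : ℕ) (x : ℝ), 0 < x → (m : ℝ) ≤ n →
      x ^ m = (m / n : ℝ) ^ m * Real.exp (m * Real.log x - m * Real.log (m / n)) := by
    intro m x hx hm
    rcases Nat.eq_zero_or_pos m with rfl | hm0
    · simp
    · have : (0 : ℝ) < m := Nat.cast_pos.2 hm0
      rw [Real.exp_sub, Real.exp_nat_mul, Real.exp_nat_mul, Real.exp_log hx,
        Real.exp_log (by positivity)]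
      field_simp
  have e1 : (1 - k / n : ℝ) = ((n - k : ℕ) : ℝ) / n := by
    rw [Nat.cast_sub hk]; field_simp
  have e2 : -(n * kl (k / n) q) = (k * Real.log q - k * Real.log (k / n)) +
      (((n - k : ℕ) : ℝ) * Real.log (1 - q) - ((n - k : ℕ) : ℝ) *
        Real.log (((n - k : ℕ) : ℝ) / n)) := by
    rw [kl, Real.binEntropy, Real.log_inv, Real.log_inv, e1]
    field_simp
    ring
  rw [e2, Real.exp_add, pre, bin, bin, e1, hpow k q hq.1 (by exact_mod_cast hk),
    hpow (n - k) (1 - q) hq1 (by exact_mod_cast Nat.sub_le n k)]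
  ring

lemma factorial_eq_stirlingSeq (n : ℕ) (hn : 0 < n) :
    (n.factorial : ℝ) = Stirling.stirlingSeq n * (√(2 * n) * (n / Real.exp 1) ^ n) := by
  have : (0 : ℝ) < n := Nat.cast_pos.2 hn
  rw [Stirling.stirlingSeq, div_mul_cancel₀]
  positivity

lemma stirlingSeq_pos {n : ℕ} (hn : 0 < n) : 0 < Stirling.stirlingSeq n := by
  obtain ⟨m, rfl⟩ := Nat.exists_eq_succ_of_ne_zero hn.ne'
  exact Stirling.stirlingSeq'_pos m

lemma pre_eq {n k : ℕ} (hk0 : 0 < k) (hkn : k < n) :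
    pre n k = Stirling.stirlingSeq n * √(2 * n) /
      (Stirling.stirlingSeq k * √(2 * k) *
        (Stirling.stirlingSeq (n - k) * √(2 * (n - k : ℕ)))) := by
  have hn : 0 < n := hk0.trans hkn
  have hm : 0 < n - k := by omega
  have hk' : (0 : ℝ) < k := Nat.cast_pos.2 hk0
  have hn' : (0 : ℝ) < n := Nat.cast_pos.2 hn
  have hm' : (0 : ℝ) < (n - k : ℕ) := Nat.cast_pos.2 hm
  have e1 : (1 - k / n : ℝ) = ((n - k : ℕ) : ℝ) / n := by
    rw [Nat.cast_sub hkn.le]; field_simp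
  have h1 := stirlingSeq_pos hk0
  have h2 := stirlingSeq_pos hm
  rw [pre, bin, e1, Nat.cast_choose ℝ hkn.le, factorial_eq_stirlingSeq n hn,
    factorial_eq_stirlingSeq k hk0, factorial_eq_stirlingSeq (n - k) hm]
  have h3 : 0 < √(2 * (k : ℝ)) := by positivity
  have h4 : 0 < √(2 * ((n - k : ℕ) : ℝ)) := by positivity
  have e3 : (n : ℝ) ^ n = (n : ℝ) ^ k * (n : ℝ) ^ (n - k) := by
    rw [← pow_add, Nat.add_sub_cancel' hkn.le]
  have e4 : (Real.exp 1) ^ n = (Real.exp 1) ^ k * (Real.exp 1) ^ (n - k) := by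
    rw [← pow_add, Nat.add_sub_cancel' hkn.le]
  simp only [div_pow]
  rw [e3, e4]
  have h5 := Real.exp_pos 1
  field_simp

lemma exists_le_pre : ∃ c > 0, ∀ n k : ℕ, 0 < n → k ≤ n → c / n ≤ pre n k := by
  obtain ⟨A, hA, hA'⟩ := Stirling.stirlingSeq'_bounded_by_pos_constant
  have hlow : ∀ n : ℕ, 0 < n → A ≤ Stirling.stirlingSeq n := fun n hn => by
    obtain ⟨m, rfl⟩ := Nat.exists_eq_succ_of_ne_zero hn.ne'
    exact hA' m
  have hB : 0 < Stirling.stirlingSeq 1 := stirlingSeq_pos one_pos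
  have hup : ∀ n : ℕ, 0 < n → Stirling.stirlingSeq n ≤ Stirling.stirlingSeq 1 := fun n hn => by
    obtain ⟨m, rfl⟩ := Nat.exists_eq_succ_of_ne_zero hn.ne'
    exact Stirling.stirlingSeq'_antitone (Nat.zero_le m)
  set B := Stirling.stirlingSeq 1
  refine ⟨min 1 (A / (2 * (B * B))), by positivity, fun n k hn hk => ?_⟩
  have hn1 : (1 : ℝ) ≤ n := by exact_mod_cast hn
  have hn' : (0 : ℝ) < n := by linarith
  have htriv : min 1 (A / (2 * (B * B))) / n ≤ 1 :=
    (div_le_one hn').2 ((min_le_left _ _).trans hn1)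
  rcases Nat.eq_zero_or_pos k with rfl | hk0
  · simpa [pre, bin] using htriv
  rcases hk.eq_or_lt with rfl | hkn
  · simpa [pre, bin, hn'.ne'] using htriv
  have hm : 0 < n - k := by omega
  have hk' : (0 : ℝ) < k := Nat.cast_pos.2 hk0
  have hm' : (0 : ℝ) < (n - k : ℕ) := Nat.cast_pos.2 hm
  have h1 := stirlingSeq_pos hk0
  have h2 := stirlingSeq_pos hm
  rw [pre_eq hk0 hkn]
  have hs : √(2 * (k : ℝ)) * √(2 * ((n - k : ℕ) : ℝ)) ≤ 2 * n := by
    rw [← Real.sqrt_mul (by positivity)]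
    refine Real.sqrt_le_iff.2 ⟨by positivity, ?_⟩
    have : (k : ℝ) + (n - k : ℕ) = n := by exact_mod_cast Nat.add_sub_cancel' hkn.le
    nlinarith
  have hs1 : 1 ≤ √(2 * (n : ℝ)) := Real.one_le_sqrt.2 (by linarith)
  calc min 1 (A / (2 * (B * B))) / n ≤ A / (2 * (B * B)) / n := by
        gcongr; exact min_le_right _ _
    _ = A * 1 / (B * B * (2 * n)) := by field_simp
    _ ≤ Stirling.stirlingSeq n * √(2 * n) / (Stirling.stirlingSeq k * Stirling.stirlingSeq (n - k) *
        (√(2 * (k : ℝ)) * √(2 * ((n - k : ℕ) : ℝ)))) := by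
        refine div_le_div₀ (by have := stirlingSeq_pos hn; positivity)
          (mul_le_mul (hlow n hn) hs1 zero_le_one (stirlingSeq_pos hn).le) (by positivity)
          (mul_le_mul (mul_le_mul (hup k hk0) (hup _ hm) h2.le hB.le) hs (by positivity)
            (by positivity))
    _ = _ := by ring_nf

lemma eventually_exp_neg_le_div {η c : ℝ} (hη : 0 < η) (hc : 0 < c) :
    ∀ᶠ n : ℕ in atTop, Real.exp (-(n * η)) ≤ c / n := by
  have h := (Real.tendsto_pow_mul_exp_neg_atTop_nhds_zero 1).comp
    (tendsto_natCast_atTop_atTop.atTop_mul_const hη : Tendsto (fun n : ℕ => (n : ℝ) * η) atTop atTop)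
  filter_upwards [h.eventually_lt_const (mul_pos hc hη), eventually_gt_atTop 0] with n hn hn0
  have hn' : (0 : ℝ) < n := Nat.cast_pos.2 hn0
  simp only [Function.comp, pow_one] at hn
  rw [le_div_iff₀ hn']
  nlinarith

lemma eventually_exp_le_bin {q η : ℝ} (hq : q ∈ Set.Ioo (0 : ℝ) 1) (hη : 0 < η) :
    ∀ᶠ n : ℕ in atTop, ∀ k ≤ n, Real.exp (-(n * (kl (k / n) q + η))) ≤ bin n q k := by
  obtain ⟨c, hc, h⟩ := exists_le_pre
  filter_upwards [eventually_exp_neg_le_div hη hc, eventually_gt_atTop 0] with n hn hn0 k hk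
  rw [bin_eq_pre_mul_exp hq hn0 hk, mul_add, neg_add_rev, Real.exp_add]
  exact mul_le_mul_of_nonneg_right (hn.trans (h n k hn0 hk)) (Real.exp_pos _).le

/-! ### The law of the weight of a Bernoulli word -/

/-- The number of ones in a binary word. -/
def weight {n : ℕ} (x : Fin n → Fin 2) : ℕ := ∑ i, (x i : ℕ)

lemma weight_eq_card {n : ℕ} (x : Fin n → Fin 2) :
    weight x = (Finset.univ.filter fun i => x i = 1).card := by
  rw [weight, Finset.card_filter]
  refine Finset.sum_congr rfl fun i _ => ?_
  generalize x i = y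
  fin_cases y <;> simp

lemma weight_le {n : ℕ} (x : Fin n → Fin 2) : weight x ≤ n := by
  rw [weight_eq_card]
  exact (Finset.card_le_univ _).trans_eq (Fintype.card_fin n)

lemma bern_singleton {p : ℝ} (hp : p ∈ Set.Icc (0 : ℝ) 1) (i : Fin 2) :
    bern p {i} = ENNReal.ofReal (if i = 1 then p else 1 - p) := by
  fin_cases i
  · simpa using bern_zero hp
  · simpa using bern_one hp

lemma pi_bern_singleton {n : ℕ} {p : ℝ} (hp : p ∈ Set.Icc (0 : ℝ) 1) (x : Fin n → Fin 2) :
    Measure.pi (fun _ : Fin n => bern p) {x} =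
      ENNReal.ofReal (p ^ weight x * (1 - p) ^ (n - weight x)) := by
  have h1p : 0 ≤ 1 - p := sub_nonneg.2 hp.2
  rw [Measure.pi_singleton]
  simp only [bern_singleton hp]
  rw [← ENNReal.ofReal_prod_of_nonneg fun i _ => by split_ifs; exacts [hp.1, h1p],
    Finset.prod_ite, Finset.prod_const, Finset.prod_const, ← weight_eq_card,
    Finset.filter_not, Finset.card_sdiff_of_subset (Finset.filter_subset _ _), ← weight_eq_card,
    Finset.card_univ, Fintype.card_fin]

lemma card_weight_eq (n k : ℕ) :
    (Finset.univ.filter fun x : Fin n → Fin 2 => weight x = k).card = n.choose k := by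
  have h : (Finset.powersetCard k (Finset.univ : Finset (Fin n))).card = n.choose k := by
    rw [Finset.card_powersetCard, Finset.card_univ, Fintype.card_fin]
  rw [← h]
  refine Finset.card_nbij' (fun x => Finset.univ.filter fun i => x i = 1)
    (fun s i => if i ∈ s then 1 else 0) ?_ ?_ ?_ ?_
  · intro x hx
    have hx : weight x = k := by simpa using hx
    simp [Finset.mem_powersetCard, ← weight_eq_card, hx]
  · intro s hs
    have hs : s.card = k := by simpa [Finset.mem_powersetCard] using hs
    simp [weight_eq_card, hs]
  · intro x _
    funext i
    simp only [Finset.mem_filter, Finset.mem_univ, true_and]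
    generalize x i = y
    fin_cases y <;> simp
  · intro s _
    ext i
    simp

/-- The law of the number of ones in a word of `n` independent letters of law `bern p`. -/
def weightLaw (n : ℕ) (p : ℝ) : Measure ℕ := (Measure.pi fun _ : Fin n => bern p).map weight

instance (n : ℕ) (p : ℝ) : IsProbabilityMeasure (weightLaw n p) :=
  Measure.isProbabilityMeasure_map (Measurable.of_discrete).aemeasurable

lemma weightLaw_apply (n : ℕ) (p : ℝ) (S : Set ℕ) :
    weightLaw n p S = (Measure.pi fun _ : Fin n => bern p) {x | weight x ∈ S} :=
  Measure.map_apply .of_discrete .of_discrete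

lemma weightLaw_singleton {p : ℝ} (hp : p ∈ Set.Icc (0 : ℝ) 1) (n k : ℕ) :
    weightLaw n p {k} = ENNReal.ofReal (bin n p k) := by
  have e : {x : Fin n → Fin 2 | weight x ∈ ({k} : Set ℕ)} =
      ((Finset.univ.filter fun x : Fin n → Fin 2 => weight x = k : Finset _) : Set _) := by
    ext x; simp
  rw [weightLaw_apply, e, ← sum_measure_singleton,
    Finset.sum_congr rfl (g := fun _ => ENNReal.ofReal (p ^ k * (1 - p) ^ (n - k)))
      fun x hx => by rw [pi_bern_singleton hp, (Finset.mem_filter.1 hx).2],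
    Finset.sum_const, card_weight_eq, nsmul_eq_mul, bin, mul_assoc,
    ENNReal.ofReal_mul (Nat.cast_nonneg _), ENNReal.ofReal_natCast]

lemma weightLaw_finset {p : ℝ} (hp : p ∈ Set.Icc (0 : ℝ) 1) (n : ℕ) (s : Finset ℕ) :
    weightLaw n p s = ENNReal.ofReal (∑ k ∈ s, bin n p k) := by
  rw [← sum_measure_singleton, ENNReal.ofReal_sum_of_nonneg fun k _ => bin_nonneg hp n k]
  exact Finset.sum_congr rfl fun k _ => weightLaw_singleton hp n k

lemma weightLaw_Iio {p : ℝ} (hp : p ∈ Set.Icc (0 : ℝ) 1) (n k : ℕ) :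
    weightLaw n p (Set.Iio k) = ENNReal.ofReal (∑ j ∈ Finset.range k, bin n p j) := by
  rw [← weightLaw_finset hp, Finset.coe_range]

lemma weightLaw_Ici {p : ℝ} (hp : p ∈ Set.Icc (0 : ℝ) 1) (n k : ℕ) :
    weightLaw n p (Set.Ici k) = ENNReal.ofReal (tail n p k) := by
  rw [tail, ← weightLaw_finset hp, weightLaw_apply, weightLaw_apply]
  congr 1
  ext x
  have := weight_le x
  simp only [Set.mem_Ici, Set.mem_ofPred_eq, Finset.coe_Ico, Set.mem_Ico]
  omega

lemma weightLaw_real_Iic {p : ℝ} (hp : p ∈ Set.Icc (0 : ℝ) 1) (n k : ℕ) :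
    (weightLaw n p).real (Set.Iic k) = 1 - tail n p (k + 1) := by
  have h : (Set.Iic k) = (Set.Ici (k + 1))ᶜ := by
    ext j; simp only [Set.mem_Iic, Set.mem_compl_iff, Set.mem_Ici]; omega
  rw [h, probReal_compl_eq_one_sub measurableSet_Ici, measureReal_def, weightLaw_Ici hp,
    ENNReal.toReal_ofReal (tail_nonneg hp n _)]

/-! ### From couplings of weights to couplings of words -/

lemma abs_weight_sub_le {n : ℕ} (x y : Fin n → Fin 2) :
    |(weight x : ℝ) - weight y| ≤ ∑ i, hamming (x i) (y i) := by
  rw [weight, weight, Nat.cast_sum, Nat.cast_sum, ← Finset.sum_sub_distrib]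
  refine (Finset.abs_sum_le_sum_abs _ _).trans (Finset.sum_le_sum fun i _ => ?_)
  rw [hamming]
  generalize x i = s
  generalize y i = t
  fin_cases s <;> fin_cases t <;> simp

lemma lt_avgCost_iff {n : ℕ} (hn : 0 < n) (α : ℝ) (x y : Fin n → Fin 2) :
    α < avgCost hamming n x y ↔ α * n < ∑ i, hamming (x i) (y i) := by
  rw [avgCost, one_div, inv_mul_eq_div, lt_div_iff₀ (Nat.cast_pos.2 hn)]

/-- The word of length `n` with `i` ones followed by zeros. -/
def sorted (n i : ℕ) : Fin n → Fin 2 := fun k => if (k : ℕ) < i then 1 else 0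

lemma hamming_comm (x y : Fin 2) : hamming x y = hamming y x := by
  simp only [hamming, eq_comm]

lemma sum_hamming_sorted_le (n i j : ℕ) (σ : Equiv.Perm (Fin n)) :
    ∑ k, hamming (sorted n i (σ k)) (sorted n j (σ k)) ≤ |(i : ℝ) - j| := by
  rw [Equiv.sum_comp σ fun k => hamming (sorted n i k) (sorted n j k)]
  wlog hij : i ≤ j generalizing i j
  · have h := this j i (by omega)
    rw [abs_sub_comm]
    exact (Finset.sum_congr rfl fun k _ => hamming_comm _ _).trans_le h
  have h1 : ∀ k : Fin n, hamming (sorted n i k) (sorted n j k) =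
      if i ≤ (k : ℕ) ∧ (k : ℕ) < j then 1 else 0 := by
    intro k
    simp only [hamming, sorted]
    split_ifs <;> first | rfl | (exfalso; omega)
  rw [Finset.sum_congr rfl fun k _ => h1 k, Finset.sum_boole, abs_sub_comm, abs_of_nonneg
    (sub_nonneg.2 (Nat.cast_le.2 hij)), ← Nat.cast_sub hij, Nat.cast_le, ← Nat.card_Ico]
  refine Finset.card_le_card_of_injOn (fun k => (k : ℕ)) (fun k hk => ?_)
    (fun k _ l _ h => Fin.ext h)
  simpa using hk

lemma exists_perm_sorted {n : ℕ} (x : Fin n → Fin 2) :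
    ∃ τ : Equiv.Perm (Fin n), sorted n (weight x) = x ∘ τ := by
  have hw : weight (sorted n (weight x)) = weight x := by
    have h1 : ∀ k : Fin n, ((sorted n (weight x) k : Fin 2) : ℕ) =
        if (k : ℕ) < weight x then 1 else 0 := fun k => by
      rw [sorted]; split_ifs <;> rfl
    conv_lhs => rw [weight]
    rw [Finset.sum_congr rfl fun k _ => h1 k,
      Fin.sum_univ_eq_sum_range (fun k => if k < weight x then 1 else 0) n, Finset.sum_boole]
    have : (Finset.range n).filter (fun k => k < weight x) = Finset.range (weight x) := by
      ext k
      have := weight_le x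
      simp only [Finset.mem_filter, Finset.mem_range]
      omega
    rw [this]
    simp
  set y := sorted n (weight x)
  have hcard : ∀ c : Fin 2, Nonempty ({k // y k = c} ≃ {k // x k = c}) := by
    have h1 : Fintype.card {k // y k = 1} = Fintype.card {k // x k = 1} := by
      rw [Fintype.card_subtype, Fintype.card_subtype, ← weight_eq_card, ← weight_eq_card, hw]
    have key : ∀ z : Fin n → Fin 2, Fintype.card {k // z k = 0} =
        n - Fintype.card {k // z k = 1} := by
      intro z
      have h2 := Fintype.card_subtype_compl (fun k => z k = 1)
      rw [Fintype.card_fin] at h2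
      rw [← h2]
      refine Fintype.card_congr (Equiv.subtypeEquivRight fun k => ?_)
      generalize z k = t
      fin_cases t <;> simp
    intro c
    refine ⟨Fintype.equivOfCardEq ?_⟩
    fin_cases c
    · simp only [Fin.zero_eta]
      rw [key, key, h1]
    · exact h1
  refine ⟨Equiv.ofFiberEquiv fun c => (hcard c).some, funext fun k => ?_⟩
  exact (Equiv.ofFiberEquiv_map (f := y) (g := x) _ k).symm

lemma map_comp_perm_pi {n : ℕ} (μ : Measure (Fin 2)) [IsProbabilityMeasure μ]
    (σ : Equiv.Perm (Fin n)) :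
    (Measure.pi fun _ : Fin n => μ).map (fun x => x ∘ σ) = Measure.pi fun _ : Fin n => μ := by
  refine Measure.ext_of_singleton fun x => ?_
  have e : (fun y : Fin n → Fin 2 => y ∘ σ) ⁻¹' {x} = {x ∘ σ.symm} := by
    ext y
    simp only [Set.mem_preimage, Set.mem_singleton_iff]
    exact ⟨fun h => by rw [← h]; ext k; simp, fun h => by rw [h]; ext k; simp⟩
  rw [Measure.map_apply .of_discrete .of_discrete, e, Measure.pi_singleton, Measure.pi_singleton]
  exact Equiv.prod_comp σ.symm fun k => μ {x k}

lemma average_sorted_perm (n : ℕ) (p : ℝ) :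
    (Fintype.card (Equiv.Perm (Fin n)) : ℝ≥0∞)⁻¹ •
      ∑ σ : Equiv.Perm (Fin n), (weightLaw n p).map (fun i => sorted n i ∘ σ) =
      Measure.pi fun _ : Fin n => bern p := by
  set μ := Measure.pi fun _ : Fin n => bern p with hμ
  ext A hA
  have h1 : ∀ f : (Fin n → Fin 2) → (Fin n → Fin 2), μ.map f A =
      ∑ x, A.indicator 1 (f x) * μ {x} := by
    intro f
    rw [← lintegral_indicator_one hA, lintegral_map .of_discrete .of_discrete, lintegral_fintype]
  have h2 : ∀ σ : Equiv.Perm (Fin n), (weightLaw n p).map (fun i => sorted n i ∘ σ) A =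
      ∑ x, A.indicator 1 (sorted n (weight x) ∘ σ) * μ {x} := fun σ => by
    rw [weightLaw, Measure.map_map .of_discrete .of_discrete, ← hμ, h1]
    rfl
  have h3 : ∑ σ : Equiv.Perm (Fin n), (weightLaw n p).map (fun i => sorted n i ∘ σ) A =
      ∑ σ : Equiv.Perm (Fin n), μ.map (fun x => x ∘ σ) A := by
    rw [Finset.sum_congr rfl fun σ _ => h2 σ,
      Finset.sum_congr rfl fun (σ : Equiv.Perm (Fin n)) _ => h1 (fun x => x ∘ σ),
      Finset.sum_comm, Finset.sum_comm (s := Finset.univ) (t := Finset.univ)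
        (f := fun (σ : Equiv.Perm (Fin n)) x => A.indicator 1 (x ∘ σ) * μ {x})]
    refine Finset.sum_congr rfl fun x _ => ?_
    obtain ⟨τ, hτ⟩ := exists_perm_sorted x
    rw [hτ]
    exact Equiv.sum_comp (Equiv.mulLeft τ)
      fun σ : Equiv.Perm (Fin n) => A.indicator (1 : (Fin n → Fin 2) → ℝ≥0∞) (x ∘ σ) * μ {x}
  rw [Measure.smul_apply, Measure.finsetSum_apply, h3]
  simp only [hμ, map_comp_perm_pi]
  rw [Finset.sum_const, Finset.card_univ, nsmul_eq_mul, smul_eq_mul, ← mul_assoc,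
    ENNReal.inv_mul_cancel (by simp [Fintype.card_ne_zero]) (by simp), one_mul]

/-- Each coupling of the weights bounds the optimal excess-cost probability of the words. -/
lemma G_le_of_coupling {n : ℕ} (hn : 0 < n) (a b α : ℝ) {γ : Measure (ℕ × ℕ)}
    (hγ : γ ∈ couplings (weightLaw n a) (weightLaw n b)) :
    G a b α n ≤ γ {q | α * n < |(q.1 : ℝ) - q.2|} := by
  set c := (Fintype.card (Equiv.Perm (Fin n)) : ℝ≥0∞)⁻¹ with hc
  set T : Equiv.Perm (Fin n) → ℕ × ℕ → (Fin n → Fin 2) × (Fin n → Fin 2) :=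
    fun σ q => (sorted n q.1 ∘ σ, sorted n q.2 ∘ σ) with hT
  set π := c • ∑ σ, γ.map (T σ) with hπ
  have hmem : π ∈ couplings (Measure.pi fun _ : Fin n => bern a)
      (Measure.pi fun _ : Fin n => bern b) := by
    constructor
    · rw [hπ, Measure.map_smul, Measure.map_finset_sum Measurable.of_discrete.aemeasurable,
        ← average_sorted_perm, ← hγ.1]
      congr 1
      refine Finset.sum_congr rfl fun σ _ => ?_
      rw [Measure.map_map .of_discrete .of_discrete, Measure.map_map .of_discrete .of_discrete]
      rfl
    · rw [hπ, Measure.map_smul, Measure.map_finset_sum Measurable.of_discrete.aemeasurable,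
        ← average_sorted_perm, ← hγ.2]
      congr 1
      refine Finset.sum_congr rfl fun σ _ => ?_
      rw [Measure.map_map .of_discrete .of_discrete, Measure.map_map .of_discrete .of_discrete]
      rfl
  refine (iInf₂_le π hmem).trans ?_
  rw [hπ, Measure.smul_apply, Measure.finsetSum_apply]
  calc c • ∑ σ, γ.map (T σ) {p | α < avgCost hamming n p.1 p.2}
      ≤ c • ∑ σ : Equiv.Perm (Fin n), γ {q | α * n < |(q.1 : ℝ) - q.2|} := by
        refine mul_le_mul_right (Finset.sum_le_sum fun σ _ => ?_) c
        rw [Measure.map_apply .of_discrete .of_discrete]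
        refine measure_mono fun q hq => ?_
        have hq' := (lt_avgCost_iff hn α _ _).1 hq
        exact hq'.trans_le (sum_hamming_sorted_le n q.1 q.2 σ)
    _ = _ := by
        rw [Finset.sum_const, Finset.card_univ, nsmul_eq_mul, smul_eq_mul, ← mul_assoc, hc,
          ENNReal.inv_mul_cancel (by simp [Fintype.card_ne_zero]) (by simp), one_mul]

/-! ### Bounds on the optimal excess-cost probability -/

lemma weight_lt_or_lt_avgCost {n : ℕ} (hn : 0 < n) {α : ℝ} {k : ℕ} (x y : Fin n → Fin 2)
    (hx : weight x < k) (hy : k + ⌊α * n⌋₊ ≤ weight y) : α < avgCost hamming n x y := by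
  rw [lt_avgCost_iff hn]
  have h1 := abs_weight_sub_le x y
  have h2 := Nat.lt_floor_add_one (α * n)
  have h3 : (weight x : ℝ) + 1 ≤ k := by exact_mod_cast hx
  have h4 : (k : ℝ) + ⌊α * n⌋₊ ≤ weight y := by exact_mod_cast hy
  have h5 := neg_abs_le ((weight x : ℝ) - weight y)
  linarith

lemma map_weight_fst {n : ℕ} {a b : ℝ} {π : Measure ((Fin n → Fin 2) × (Fin n → Fin 2))}
    (hπ : π ∈ couplings (Measure.pi fun _ : Fin n => bern a) (Measure.pi fun _ : Fin n => bern b))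
    (S : Set ℕ) : π {p | weight p.1 ∈ S} = weightLaw n a S := by
  rw [weightLaw_apply, ← hπ.1, Measure.map_apply .of_discrete .of_discrete]
  rfl

lemma map_weight_snd {n : ℕ} {a b : ℝ} {π : Measure ((Fin n → Fin 2) × (Fin n → Fin 2))}
    (hπ : π ∈ couplings (Measure.pi fun _ : Fin n => bern a) (Measure.pi fun _ : Fin n => bern b))
    (S : Set ℕ) : π {p | weight p.2 ∈ S} = weightLaw n b S := by
  rw [weightLaw_apply, ← hπ.2, Measure.map_apply .of_discrete .of_discrete]
  rfl

lemma ofReal_tail_sub_le_G {a b : ℝ} (ha : a ∈ Set.Icc (0 : ℝ) 1) (hb : b ∈ Set.Icc (0 : ℝ) 1)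
    (α : ℝ) {n : ℕ} (hn : 0 < n) (k : ℕ) :
    ENNReal.ofReal (tail n b (k + ⌊α * n⌋₊) - tail n a k) ≤ G a b α n := by
  refine le_iInf₂ fun π hπ => ?_
  rw [ENNReal.ofReal_sub _ (tail_nonneg ha n k), tsub_le_iff_right, ← weightLaw_Ici hb,
    ← weightLaw_Ici ha, ← map_weight_fst hπ, ← map_weight_snd hπ]
  refine (measure_mono fun p hp => ?_).trans (measure_union_le _ _)
  by_cases h : k ≤ weight p.1
  · exact Or.inr h
  · exact Or.inl (weight_lt_or_lt_avgCost hn _ _ (not_le.1 h) hp)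

lemma one_sub_G_le {a b : ℝ} (ha : a ∈ Set.Icc (0 : ℝ) 1) (hb : b ∈ Set.Icc (0 : ℝ) 1)
    (α : ℝ) {n : ℕ} (hn : 0 < n) (k : ℕ) :
    1 - G a b α n ≤ ENNReal.ofReal (tail n a k + ∑ j ∈ Finset.range (k + ⌊α * n⌋₊), bin n b j) := by
  rw [tsub_le_iff_left, ← tsub_le_iff_right]
  refine le_iInf₂ fun π hπ => ?_
  rw [tsub_le_iff_right, ENNReal.ofReal_add (tail_nonneg ha n k)
    (Finset.sum_nonneg fun j _ => bin_nonneg hb n j), ← weightLaw_Ici ha, ← weightLaw_Iio hb,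
    ← map_weight_fst hπ, ← map_weight_snd hπ]
  have huniv : π Set.univ = 1 := by
    have := map_weight_fst hπ Set.univ
    simpa using this
  rw [← huniv]
  refine (measure_mono fun p _ => ?_).trans ((measure_union_le _ _).trans
    (add_le_add_right (measure_union_le _ _) _))
  by_cases h : k ≤ weight p.1
  · exact Or.inr (Or.inl h)
  · by_cases h' : weight p.2 < k + ⌊α * n⌋₊
    · exact Or.inr (Or.inr h')
    · exact Or.inl (weight_lt_or_lt_avgCost hn _ _ (not_le.1 h) (not_lt.1 h'))

/-- Two probability measures have a coupling with at least half of the largest possible mass at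
a given point. -/
lemma exists_coupling_singleton (μ ν : Measure ℕ)
    [IsProbabilityMeasure μ] [IsProbabilityMeasure ν] (i j : ℕ) :
    ∃ γ ∈ couplings μ ν, min (μ {i}) (ν {j}) / 2 ≤ γ {(i, j)} ∧ γ Set.univ = 1 := by
  set m := min (μ {i}) (ν {j}) / 2 with hm
  have hm1 : m < 1 := by
    have : min (μ {i}) (ν {j}) ≤ 1 := (min_le_left _ _).trans prob_le_one
    calc m ≤ 1 / 2 := by rw [hm]; gcongr
      _ < 1 := ENNReal.half_lt_self one_ne_zero ENNReal.one_ne_top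
  have hmt : m ≠ ∞ := (hm1.trans ENNReal.one_lt_top).ne
  have hsplit : ∀ (ρ : Measure ℕ) [IsProbabilityMeasure ρ] (z : ℕ), m ≤ ρ {z} →
      ∃ τ : Measure ℕ, IsFiniteMeasure τ ∧ τ + m • Measure.dirac z = ρ ∧ τ Set.univ = 1 - m := by
    intro ρ _ z hz
    have hle : m • Measure.dirac z ≤ ρ := by
      refine Measure.le_iff.2 fun s _ => ?_
      rw [Measure.smul_apply, Measure.dirac_apply' _ .of_discrete, smul_eq_mul]
      by_cases hzs : z ∈ s
      · rw [Set.indicator_of_mem hzs]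
        simpa using hz.trans (measure_mono (Set.singleton_subset_iff.2 hzs))
      · simp [Set.indicator_of_notMem hzs]
    have : IsFiniteMeasure (m • Measure.dirac z) := Measure.smul_finite _ hmt
    have hadd := Measure.sub_add_cancel_of_le hle
    refine ⟨ρ - m • Measure.dirac z, inferInstance, hadd, ?_⟩
    have h1 : (ρ - m • Measure.dirac z) Set.univ + m = 1 := by
      have := congrArg (fun τ : Measure ℕ => τ Set.univ) hadd
      simpa using this
    exact ENNReal.eq_sub_of_add_eq hmt h1
  obtain ⟨ρ, hρ, hμ, hρ1⟩ := hsplit μ i (ENNReal.half_le_self.trans (min_le_left _ _))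
  obtain ⟨τ, hτ, hν, hτ1⟩ := hsplit ν j (ENNReal.half_le_self.trans (min_le_right _ _))
  have h0 : 1 - m ≠ 0 := (tsub_pos_of_lt hm1).ne'
  have hfst : (m • Measure.dirac (i, j) + (1 - m)⁻¹ • ρ.prod τ).map Prod.fst = μ := by
    rw [Measure.map_add _ _ measurable_fst, Measure.map_smul, Measure.map_smul,
      Measure.map_dirac' measurable_fst, Measure.map_fst_prod, hτ1, smul_smul,
      ENNReal.inv_mul_cancel h0 (ENNReal.sub_ne_top ENNReal.one_ne_top), one_smul, add_comm]
    exact hμ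
  refine ⟨m • Measure.dirac (i, j) + (1 - m)⁻¹ • ρ.prod τ, ⟨hfst, ?_⟩, ?_, ?_⟩
  · rw [Measure.map_add _ _ measurable_snd, Measure.map_smul, Measure.map_smul,
      Measure.map_dirac' measurable_snd, Measure.map_snd_prod, hρ1, smul_smul,
      ENNReal.inv_mul_cancel h0 (ENNReal.sub_ne_top ENNReal.one_ne_top), one_smul, add_comm]
    exact hν
  · simp
  · have h1 := congrArg (fun τ : Measure ℕ => τ Set.univ) hfst
    simp only [Measure.map_apply measurable_fst .univ, Set.preimage_univ, measure_univ] at h1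
    exact h1

lemma min_bin_half_le_one_sub_G {a b : ℝ} (ha : a ∈ Set.Icc (0 : ℝ) 1)
    (hb : b ∈ Set.Icc (0 : ℝ) 1) {α : ℝ} (hα : 0 ≤ α) {n : ℕ} (hn : 0 < n) (k : ℕ) :
    ENNReal.ofReal (min (bin n a k) (bin n b (k + ⌊α * n⌋₊)) / 2) ≤ 1 - G a b α n := by
  obtain ⟨γ, hγ, hm, h1⟩ := exists_coupling_singleton (weightLaw n a) (weightLaw n b) k
    (k + ⌊α * n⌋₊)
  have hfin : IsFiniteMeasure γ := ⟨by rw [h1]; exact ENNReal.one_lt_top⟩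
  have hle : G a b α n ≤ 1 - γ {(k, k + ⌊α * n⌋₊)} := by
    rw [← h1, ← measure_compl (measurableSet_singleton _) (measure_ne_top _ _)]
    refine (G_le_of_coupling hn a b α hγ).trans (measure_mono fun q hq hq' => ?_)
    rw [Set.mem_singleton_iff] at hq'
    have h2 := Nat.floor_le (mul_nonneg hα (Nat.cast_nonneg n))
    have h3 : α * n < |(q.1 : ℝ) - q.2| := hq
    rw [hq'] at h3
    push_cast at h3
    rw [sub_add_cancel_left, abs_neg, abs_of_nonneg (Nat.cast_nonneg _)] at h3
    linarith
  have h4 : γ {(k, k + ⌊α * n⌋₊)} ≤ 1 := (measure_mono (Set.subset_univ _)).trans_eq h1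
  rw [weightLaw_singleton ha, weightLaw_singleton hb, ← ENNReal.ofReal_min] at hm
  rw [ENNReal.ofReal_div_of_pos two_pos, ENNReal.ofReal_ofNat]
  calc _ ≤ γ {(k, k + ⌊α * n⌋₊)} := hm
    _ = 1 - (1 - γ {(k, k + ⌊α * n⌋₊)}) :=
        (ENNReal.sub_sub_cancel ENNReal.one_ne_top h4).symm
    _ ≤ 1 - G a b α n := tsub_le_tsub_left hle 1

/-! ### The quantile coupling -/

/-- The quantile function of a distribution function `F` on `ℕ` that reaches the value one. -/
def quantile (F : ℕ → ℝ) (u : ℝ) : ℕ := sInf {k | min u 1 ≤ F k}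

lemma quantile_le_iff {F : ℕ → ℝ} (hF : Monotone F) {n : ℕ} (hn : F n = 1) (u : ℝ) (k : ℕ) :
    quantile F u ≤ k ↔ min u 1 ≤ F k := by
  have hne : {k | min u 1 ≤ F k}.Nonempty := 
    ⟨n, by rw [Set.mem_ofPred_eq, hn]; exact min_le_right _ _⟩
  exact ⟨fun h => (Nat.sInf_mem hne : min u 1 ≤ F (quantile F u)).trans (hF h),
    fun h => Nat.sInf_le h⟩

lemma measurable_quantile {F : ℕ → ℝ} (hF : Monotone F) {n : ℕ} (hn : F n = 1) :
    Measurable (quantile F) := by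
  refine measurable_of_Iic fun k => ?_
  have : quantile F ⁻¹' Set.Iic k = {u | min u 1 ≤ F k} := by
    ext u; exact quantile_le_iff hF hn u k
  rw [this]
  exact measurableSet_le (measurable_id.min measurable_const) measurable_const

lemma map_quantile (μ : Measure ℕ) [IsProbabilityMeasure μ] {n : ℕ}
    (hn : μ.real (Set.Iic n) = 1) :
    ((volume : Measure ℝ).restrict (Set.Ioc 0 1)).map (quantile fun k => μ.real (Set.Iic k)) =
      μ := by
  have hF : Monotone fun k => μ.real (Set.Iic k) := fun k l h =>
    measureReal_mono (Set.Iic_subset_Iic.2 h)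
  have hm := measurable_quantile hF hn
  symm
  refine Measure.ext_of_Iic _ _ fun k => ?_
  rw [Measure.map_apply hm measurableSet_Iic, Measure.restrict_apply (hm measurableSet_Iic)]
  have : quantile (fun k => μ.real (Set.Iic k)) ⁻¹' Set.Iic k ∩ Set.Ioc 0 1 =
      Set.Ioc 0 (μ.real (Set.Iic k)) := by
    ext u
    have h := quantile_le_iff hF hn u k
    have h1 : μ.real (Set.Iic k) ≤ 1 := measureReal_le_one
    simp only [Set.mem_inter_iff, Set.mem_preimage, Set.mem_Iic, h, Set.mem_Ioc]
    constructor
    · rintro ⟨h2, h3, h4⟩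
      exact ⟨h3, by rwa [min_eq_left h4] at h2⟩
    · rintro ⟨h2, h3⟩
      exact ⟨(min_le_left _ _).trans h3, h2, h3.trans h1⟩
  rw [this, Real.volume_Ioc, sub_zero, ofReal_measureReal]

lemma G_le_sum_tail {a b : ℝ} (ha : 0 ≤ a) (hab : a ≤ b) (hb : b ≤ 1)
    {α : ℝ} (hα : 0 ≤ α) {n : ℕ} (hn : 0 < n) :
    G a b α n ≤ ∑ v ∈ Finset.range n,
      ENNReal.ofReal (tail n b (v + 1 + ⌊α * n⌋₊) - tail n a (v + 1)) := by
  have ha' : a ∈ Set.Icc (0 : ℝ) 1 := ⟨ha, hab.trans hb⟩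
  have hb' : b ∈ Set.Icc (0 : ℝ) 1 := ⟨ha.trans hab, hb⟩
  set r := ⌊α * n⌋₊ with hr
  set F := fun k => (weightLaw n a).real (Set.Iic k) with hF
  set H := fun k => (weightLaw n b).real (Set.Iic k) with hH
  have hFk : ∀ k, F k = 1 - tail n a (k + 1) := fun k => weightLaw_real_Iic ha' n k
  have hHk : ∀ k, H k = 1 - tail n b (k + 1) := fun k => weightLaw_real_Iic hb' n k
  have hFm : Monotone F := fun k l h => measureReal_mono (Set.Iic_subset_Iic.2 h)
  have hHm : Monotone H := fun k l h => measureReal_mono (Set.Iic_subset_Iic.2 h)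
  have hFn : F n = 1 := by rw [hFk, tail_eq_zero _ (by omega), sub_zero]
  have hHn : H n = 1 := by rw [hHk, tail_eq_zero _ (by omega), sub_zero]
  have hHF : ∀ k, H k ≤ F k := fun k => by
    rw [hFk, hHk]; linarith [tail_mono ha hab hb n (k + 1)]
  have hQF := measurable_quantile hFm hFn
  have hQH := measurable_quantile hHm hHn
  set lam := (volume : Measure ℝ).restrict (Set.Ioc 0 1) with hlam
  have hmem : lam.map (fun u => (quantile F u, quantile H u)) ∈
      couplings (weightLaw n a) (weightLaw n b) := by
    constructor
    · rw [Measure.map_map measurable_fst (hQF.prodMk hQH)]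
      exact map_quantile _ hFn
    · rw [Measure.map_map measurable_snd (hQF.prodMk hQH)]
      exact map_quantile _ hHn
  refine (G_le_of_coupling hn a b α hmem).trans ?_
  rw [Measure.map_apply (hQF.prodMk hQH) .of_discrete,
    Measure.restrict_apply ((hQF.prodMk hQH) .of_discrete)]
  have hsub : (fun u => (quantile F u, quantile H u)) ⁻¹'
      {q : ℕ × ℕ | α * n < |(q.1 : ℝ) - q.2|} ∩ Set.Ioc 0 1 ⊆
      ⋃ v ∈ Finset.range n, Set.Ioc (H (v + r)) (F v) := by
    rintro u ⟨hu, hu01⟩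
    have hu : α * n < |(quantile F u : ℝ) - quantile H u| := hu
    have hmin : min u 1 = u := min_eq_left hu01.2
    have hle : quantile F u ≤ quantile H u := by
      rw [quantile_le_iff hFm hFn]
      exact ((quantile_le_iff hHm hHn u _).1 le_rfl).trans (hHF _)
    have hn' : quantile H u ≤ n := by
      rw [quantile_le_iff hHm hHn, hHn]; exact min_le_right _ _
    rw [abs_sub_comm, abs_of_nonneg (sub_nonneg.2 (Nat.cast_le.2 hle)), ← Nat.cast_sub hle] at hu
    have hlt : r < quantile H u - quantile F u :=
      (Nat.floor_lt (mul_nonneg hα (Nat.cast_nonneg n))).2 hu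
    have h1 := quantile_le_iff hHm hHn u (quantile F u + r)
    have h2 := (quantile_le_iff hFm hFn u (quantile F u)).1 le_rfl
    rw [hmin] at h1 h2
    refine Set.mem_biUnion (x := quantile F u) (by simp; omega) ⟨?_, h2⟩
    by_contra h
    have := h1.2 (not_lt.1 h)
    omega
  refine (measure_mono hsub).trans ((measure_biUnion_finset_le _ _).trans
    (Finset.sum_le_sum fun v _ => ?_))
  rw [Real.volume_Ioc, hFk, hHk, show v + r + 1 = v + 1 + r by ring]
  exact ENNReal.ofReal_le_ofReal (by linarith)

/-! ### Exponential rates -/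

lemma rate_exp {n : ℕ} (hn : 0 < n) (c : ℝ) :
    rate n (ENNReal.ofReal (Real.exp (-(n * c)))) = (c : EReal) := by
  have hn' : (n : ℝ) ≠ 0 := by positivity
  rw [rate, ENNReal.log_ofReal_of_pos (Real.exp_pos _), Real.log_exp, ← EReal.coe_mul]
  congr 1
  field_simp

lemma rate_anti (n : ℕ) {x y : ℝ≥0∞} (h : x ≤ y) : rate n y ≤ rate n x := by
  rw [rate, rate, EReal.coe_neg, EReal.neg_mul, EReal.neg_mul, EReal.neg_le_neg_iff]
  exact mul_le_mul_of_nonneg_left (ENNReal.log_monotone h)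
    (EReal.coe_nonneg.2 (by positivity))

lemma rate_zero {n : ℕ} (hn : 0 < n) : rate n 0 = ⊤ := by
  rw [rate, ENNReal.log_zero, EReal.coe_mul_bot_of_neg]
  have : (0 : ℝ) < 1 / n := by positivity
  linarith

lemma tendsto_rate {x : ℕ → ℝ≥0∞} {v : ℝ}
    (hlow : ∀ ε > 0, ∀ᶠ n : ℕ in atTop, ENNReal.ofReal (Real.exp (-(n * (v + ε)))) ≤ x n)
    (hup : ∀ ε > 0, ∀ᶠ n : ℕ in atTop, x n ≤ ENNReal.ofReal (Real.exp (-(n * (v - ε))))) :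
    Tendsto (fun n => rate n (x n)) atTop (𝓝 (v : EReal)) := by
  refine tendsto_order.2 ⟨fun u hu => ?_, fun u hu => ?_⟩
  · obtain ⟨c, hc1, hc2⟩ := EReal.lt_iff_exists_real_btwn.1 hu
    filter_upwards [hup (v - c) (sub_pos.2 (EReal.coe_lt_coe_iff.1 hc2)), eventually_gt_atTop 0]
      with n hn hn0
    refine hc1.trans_le ?_
    have := rate_anti n hn
    rwa [sub_sub_cancel, rate_exp hn0] at this
  · obtain ⟨c, hc1, hc2⟩ := EReal.lt_iff_exists_real_btwn.1 hu
    filter_upwards [hlow (c - v) (sub_pos.2 (EReal.coe_lt_coe_iff.1 hc1)), eventually_gt_atTop 0]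
      with n hn hn0
    refine lt_of_le_of_lt ?_ hc2
    have := rate_anti n hn
    rwa [add_sub_cancel, rate_exp hn0] at this

lemma eventually_const_le_exp {η : ℝ} (hη : 0 < η) (c : ℝ) :
    ∀ᶠ n : ℕ in atTop, c ≤ Real.exp (n * η) :=
  (Real.tendsto_exp_atTop.comp (tendsto_natCast_atTop_atTop.atTop_mul_const hη)).eventually_ge_atTop
    c

lemma eventually_mul_exp_le {η : ℝ} (hη : 0 < η) (c : ℝ) :
    ∀ᶠ n : ℕ in atTop, ∀ E : ℝ, c * Real.exp (-(n * E)) ≤ Real.exp (-(n * (E - η))) := by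
  filter_upwards [eventually_const_le_exp hη c] with n hn E
  rw [mul_sub, neg_sub, sub_eq_add_neg, Real.exp_add]
  exact mul_le_mul_of_nonneg_right hn (Real.exp_pos _).le

lemma eventually_natCast_mul_exp_le {η : ℝ} (hη : 0 < η) :
    ∀ᶠ n : ℕ in atTop, ∀ E : ℝ, n * Real.exp (-(n * E)) ≤ Real.exp (-(n * (E - η))) := by
  filter_upwards [eventually_exp_neg_le_div hη one_pos, eventually_gt_atTop 0] with n hn hn0 E
  have hn' : (0 : ℝ) < n := Nat.cast_pos.2 hn0
  rw [le_div_iff₀ hn'] at hn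
  rw [mul_sub, neg_sub, sub_eq_add_neg, Real.exp_add]
  refine mul_le_mul_of_nonneg_right ?_ (Real.exp_pos _).le
  rw [Real.exp_neg, inv_mul_le_iff₀ (Real.exp_pos _)] at hn
  linarith

/-- Binomial probabilities at a sequence of points of asymptotic slope `s`. -/
lemma eventually_exp_le_bin_of_tendsto {q s ε : ℝ} (hq : q ∈ Set.Ioo (0 : ℝ) 1) {k : ℕ → ℕ}
    (hk : ∀ᶠ n in atTop, k n ≤ n) (hs : Tendsto (fun n => (k n : ℝ) / n) atTop (𝓝 s))
    (hε : 0 < ε) :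
    ∀ᶠ n : ℕ in atTop, Real.exp (-(n * (kl s q + ε))) ≤ bin n q (k n) := by
  have h1 : Tendsto (fun n => kl ((k n : ℝ) / n) q) atTop (𝓝 (kl s q)) :=
    ((continuous_kl q).tendsto s).comp hs
  filter_upwards [eventually_exp_le_bin hq (half_pos hε), hk,
    h1.eventually_lt_const (by linarith : kl s q < kl s q + ε / 2)] with n hn hkn hlt
  refine le_trans (Real.exp_le_exp.2 ?_) (hn _ hkn)
  have : (0 : ℝ) ≤ n := Nat.cast_nonneg n
  nlinarith

lemma tendsto_floor_mul_div {t : ℝ} (ht : 0 ≤ t) :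
    Tendsto (fun n : ℕ => (⌊t * n⌋₊ : ℝ) / n) atTop (𝓝 t) :=
  (tendsto_nat_floor_mul_div_atTop ht).comp tendsto_natCast_atTop_atTop

lemma tendsto_ceil_mul_div {t : ℝ} (ht : 0 ≤ t) :
    Tendsto (fun n : ℕ => (⌈t * n⌉₊ : ℝ) / n) atTop (𝓝 t) :=
  (tendsto_nat_ceil_mul_div_atTop ht).comp tendsto_natCast_atTop_atTop

/-! ### Small thresholds -/

lemma tendsto_rate_one_sub_G {a b α t : ℝ} (ha : 0 ≤ a) (hb : b ∈ Set.Ioo (0 : ℝ) 1)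
    (hα : 0 ≤ α) (ht : t ∈ Set.Icc a (b - α))
    (h : (a = 0 ∧ t = 0) ∨ (0 < a ∧ kl t a = kl (t + α) b)) :
    Tendsto (fun n : ℕ => rate n (1 - G a b α n)) atTop (𝓝 (kl (t + α) b : EReal)) := by
  have ht0 : 0 ≤ t := ha.trans ht.1
  have htb : t + α ≤ b := by linarith [ht.2]
  have hb' : b ∈ Set.Icc (0 : ℝ) 1 := ⟨hb.1.le, hb.2.le⟩
  have ha' : a ∈ Set.Icc (0 : ℝ) 1 := ⟨ha, by linarith [ht.1, hb.2]⟩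
  have hfl : ∀ n : ℕ, (⌊t * n⌋₊ : ℝ) + ⌊α * n⌋₊ ≤ (t + α) * n := fun n => by
    have h1 := Nat.floor_le (mul_nonneg ht0 (Nat.cast_nonneg n))
    have h2 := Nat.floor_le (mul_nonneg hα (Nat.cast_nonneg n))
    linarith
  have hfl' : ∀ n : ℕ, ⌊t * n⌋₊ + ⌊α * n⌋₊ ≤ n := fun n => by
    have h1 : (t + α) * n ≤ n := mul_le_of_le_one_left (Nat.cast_nonneg n) (htb.trans hb.2.le)
    exact_mod_cast (hfl n).trans h1
  refine tendsto_rate (fun ε hε => ?_) fun ε hε => ?_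
  · have hbb : ∀ᶠ n : ℕ in atTop, Real.exp (-(n * (kl (t + α) b + ε / 2))) ≤
        bin n b (⌊t * n⌋₊ + ⌊α * n⌋₊) := by
      refine eventually_exp_le_bin_of_tendsto hb (Eventually.of_forall hfl') ?_ (half_pos hε)
      refine ((tendsto_floor_mul_div ht0).add (tendsto_floor_mul_div hα)).congr fun n => ?_
      rw [Nat.cast_add, add_div]
    have hba : ∀ᶠ n : ℕ in atTop, Real.exp (-(n * (kl (t + α) b + ε / 2))) ≤
        bin n a ⌊t * n⌋₊ := by
      rcases h with ⟨rfl, rfl⟩ | ⟨ha0, h⟩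
      · refine Eventually.of_forall fun n => ?_
        rw [zero_mul, Nat.floor_zero, bin_zero_zero, Real.exp_le_one_iff, neg_nonpos]
        have := kl_nonneg hb (p := 0 + α) ⟨by linarith, htb.trans hb.2.le⟩
        positivity
      · rw [← h]
        exact eventually_exp_le_bin_of_tendsto ⟨ha0, by linarith [ht.1, hb.2]⟩
          (Eventually.of_forall fun n => (Nat.le_add_right _ _).trans (hfl' n))
          (tendsto_floor_mul_div ht0) (half_pos hε)
    filter_upwards [hba, hbb, eventually_gt_atTop 0, eventually_mul_exp_le (half_pos hε) 2]
      with n h1 h2 hn h3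
    refine le_trans (ENNReal.ofReal_le_ofReal ?_) (min_bin_half_le_one_sub_G ha' hb' hα hn ⌊t * n⌋₊)
    rw [le_div_iff₀ two_pos]
    refine le_trans ?_ (le_min h1 h2)
    have := h3 (kl (t + α) b + ε)
    rw [show kl (t + α) b + ε - ε / 2 = kl (t + α) b + ε / 2 by ring] at this
    linarith
  · filter_upwards [eventually_gt_atTop 0, eventually_mul_exp_le hε 2] with n hn h3
    refine (one_sub_G_le ha' hb' α hn (⌊t * n⌋₊ + 1)).trans (ENNReal.ofReal_le_ofReal ?_)
    refine le_trans ?_ (h3 _)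
    have h1 : tail n a (⌊t * n⌋₊ + 1) ≤ Real.exp (-(n * kl (t + α) b)) := by
      rcases h with ⟨rfl, rfl⟩ | ⟨ha0, h⟩
      · rw [tail_zero_succ]; exact (Real.exp_pos _).le
      · rw [← h]
        refine tail_le_exp ⟨ha0, by linarith [ht.1, hb.2]⟩ ⟨ht.1, by linarith [hb.2]⟩ ?_
        exact_mod_cast (Nat.lt_floor_add_one _).le
    have h2 := sum_range_bin_le_exp hb (s := t + α) ⟨by linarith, htb⟩ (n := n)
      (k := ⌊t * n⌋₊ + 1 + ⌊α * n⌋₊) (by have := hfl' n; omega)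
      (by have := hfl n; push_cast; linarith)
    linarith

lemma exists_kl_eq {a b α : ℝ} (ha : 0 < a) (hb : b < 1) (hα : 0 ≤ α) (h : α < b - a) :
    ∃ t ∈ Set.Icc a (b - α), kl t a = kl (t + α) b := by
  have ha1 : a ∈ Set.Ioo (0 : ℝ) 1 := ⟨ha, by linarith⟩
  have hb1 : b ∈ Set.Ioo (0 : ℝ) 1 := ⟨by linarith, hb⟩
  have h0 : (0 : ℝ) ∈ Set.Icc (klGap a b α (b - α)) (klGap a b α a) := by
    simp only [klGap, sub_add_cancel, kl_self, Set.mem_Icc]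
    have h1 := kl_nonneg ha1 (p := b - α) ⟨by linarith, by linarith⟩
    have h2 := kl_nonneg hb1 (p := a + α) ⟨by linarith, by linarith⟩
    exact ⟨by linarith, by linarith⟩
  obtain ⟨t, ht, h1⟩ := intermediate_value_Icc' (by linarith : a ≤ b - α)
    (continuous_klGap a b α).continuousOn h0
  exact ⟨t, ht, by rw [klGap] at h1; linarith⟩

lemma small_threshold {a b α : ℝ} (ha : 0 ≤ a) (hb : b < 1) (hα : 0 ≤ α) (h : α < b - a) :
    ∃ v : ℝ≥0∞,
      IsLeast ((fun x => max (binKL (x + α) b) (binKL x a)) ''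
        {x : ℝ | x ∈ Set.Icc 0 1 ∧ x + α ∈ Set.Icc 0 1}) v ∧
      Tendsto (fun n : ℕ => rate n (1 - G a b α n)) atTop (𝓝 (v : EReal)) ∧
      (0 < a →
        ∃ x : ℝ, (x ∈ Set.Icc a (b - α) ∧ binKL (x + α) b = binKL x a) ∧
          (∀ y : ℝ, y ∈ Set.Icc a (b - α) → binKL (y + α) b = binKL y a → y = x) ∧
          v = binKL x a) := by
  have hb1 : b ∈ Set.Ioo (0 : ℝ) 1 := ⟨by linarith, hb⟩
  obtain ⟨t, ht, hcase⟩ : ∃ t ∈ Set.Icc a (b - α),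
      (a = 0 ∧ t = 0) ∨ (0 < a ∧ kl t a = kl (t + α) b) := by
    rcases ha.eq_or_lt with rfl | ha0
    · exact ⟨0, ⟨le_rfl, by linarith⟩, Or.inl ⟨rfl, rfl⟩⟩
    · obtain ⟨t, ht, h1⟩ := exists_kl_eq ha0 hb hα h
      exact ⟨t, ht, Or.inr ⟨ha0, h1⟩⟩
  have ht0 : 0 ≤ t := ha.trans ht.1
  have htb : t + α ≤ b := by linarith [ht.2]
  have htα : t + α ∈ Set.Icc (0 : ℝ) 1 := ⟨by linarith, by linarith⟩
  have ht1 : t ∈ Set.Icc (0 : ℝ) 1 := ⟨ht0, by linarith⟩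
  have hle : binKL t a ≤ binKL (t + α) b := by
    rcases hcase with ⟨rfl, rfl⟩ | ⟨ha0, h1⟩
    · rw [binKL_self]; exact zero_le
    · rw [binKL_eq hb1 htα, binKL_eq ⟨ha0, by linarith⟩ ht1, h1]
  refine ⟨binKL (t + α) b, ⟨⟨t, ⟨ht1, htα⟩, max_eq_left hle⟩, ?_⟩, ?_, fun ha0 => ?_⟩
  · rintro _ ⟨x, ⟨hx, hxα⟩, rfl⟩
    rcases le_or_gt x t with hxt | hxt
    · refine le_max_of_le_left ?_
      rw [binKL_eq hb1 htα, binKL_eq hb1 hxα]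
      exact ENNReal.ofReal_le_ofReal ((kl_strictAntiOn hb1).antitoneOn
        ⟨hxα.1, by linarith⟩ ⟨htα.1, htb⟩ (by linarith))
    · refine le_max_of_le_right ?_
      rcases hcase with ⟨rfl, rfl⟩ | ⟨ha0, h1⟩
      · simp only [binKL_zero_right hxt hx.2, le_top]
      · have ha1 : a ∈ Set.Ioo (0 : ℝ) 1 := ⟨ha0, by linarith⟩
        rw [binKL_eq hb1 htα, binKL_eq ha1 hx, ← h1]
        exact ENNReal.ofReal_le_ofReal ((kl_strictMonoOn ha1).monotoneOn
          ⟨ht.1, ht1.2⟩ ⟨ht.1.trans hxt.le, hx.2⟩ hxt.le)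
  · have := tendsto_rate_one_sub_G ha hb1 hα ht hcase
    rwa [binKL_eq hb1 htα, EReal.coe_ennreal_ofReal, max_eq_left (kl_nonneg hb1 htα)]
  · have h1 : kl t a = kl (t + α) b := by
      rcases hcase with ⟨rfl, -⟩ | ⟨-, h1⟩
      · exact absurd ha0 (lt_irrefl _)
      · exact h1
    have ha1 : a ∈ Set.Ioo (0 : ℝ) 1 := ⟨ha0, by linarith⟩
    have e : binKL (t + α) b = binKL t a := by rw [binKL_eq hb1 htα, binKL_eq ha1 ht1, h1]
    refine ⟨t, ⟨ht, e⟩, fun y hy hye => ?_, e⟩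
    have hy1 : y ∈ Set.Icc (0 : ℝ) 1 := ⟨by linarith [hy.1], by linarith [hy.2]⟩
    have hyα : y + α ∈ Set.Icc (0 : ℝ) 1 := ⟨by linarith [hy.1], by linarith [hy.2]⟩
    rw [binKL_eq hb1 hyα, binKL_eq ha1 hy1, ENNReal.ofReal_eq_ofReal_iff (kl_nonneg hb1 hyα)
      (kl_nonneg ha1 hy1)] at hye
    rcases lt_trichotomy y t with hlt | heq | hlt
    · have h2 := kl_strictMonoOn ha1 ⟨hy.1, hy1.2⟩ ⟨ht.1, ht1.2⟩ hlt
      have h3 := kl_strictAntiOn hb1 (a := y + α) ⟨hyα.1, by linarith [hy.2]⟩ (b := t + α)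
        ⟨htα.1, htb⟩ (by linarith)
      simp only at h2 h3
      linarith
    · exact heq
    · have h2 := kl_strictMonoOn ha1 ⟨ht.1, ht1.2⟩ ⟨hy.1, hy1.2⟩ hlt
      have h3 := kl_strictAntiOn hb1 (a := t + α) ⟨htα.1, htb⟩ (b := y + α)
        ⟨hyα.1, by linarith [hy.2]⟩ (by linarith)
      simp only at h2 h3
      linarith

/-! ### Large thresholds: comparison of the tails -/

lemma eventually_kl_le_of_abs_sub_le (q : ℝ) {η : ℝ} (hη : 0 < η) :
    ∀ᶠ n : ℕ in atTop, ∀ x ∈ Set.Icc (0 : ℝ) 1, ∀ y ∈ Set.Icc (0 : ℝ) 1, |x - y| ≤ 1 / n →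
      kl x q ≤ kl y q + η := by
  have h := isCompact_Icc.uniformContinuousOn_of_continuous
    (continuous_kl q).continuousOn (s := Set.Icc (0 : ℝ) 1)
  obtain ⟨δ, hδ, h⟩ := Metric.uniformContinuousOn_iff.1 h η hη
  filter_upwards [tendsto_one_div_atTop_nhds_zero_nat.eventually_lt_const hδ] with n hn x hx y hy hxy
  have := h x hx y hy (by rw [Real.dist_eq]; exact hxy.trans_lt hn)
  rw [Real.dist_eq] at this
  linarith [(abs_lt.1 this).2]

lemma abs_floor_div_sub_le {n : ℕ} (hn : 0 < n) {x : ℝ} (hx : 0 ≤ x) :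
    |(⌊x * n⌋₊ : ℝ) / n - x| ≤ 1 / n := by
  have hn' : (0 : ℝ) < n := Nat.cast_pos.2 hn
  have h1 := Nat.floor_le (mul_nonneg hx hn'.le)
  have h2 := Nat.lt_floor_add_one (x * n)
  have e : (⌊x * n⌋₊ : ℝ) / n - x = (⌊x * n⌋₊ - x * n) / n := by field_simp
  rw [e, abs_div, abs_of_pos hn']
  exact div_le_div_of_nonneg_right (abs_le.2 ⟨by linarith, by linarith⟩) hn'.le

lemma abs_ceil_div_sub_le {n : ℕ} (hn : 0 < n) {x : ℝ} (hx : 0 ≤ x) :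
    |(⌈x * n⌉₊ : ℝ) / n - x| ≤ 1 / n := by
  have hn' : (0 : ℝ) < n := Nat.cast_pos.2 hn
  have h1 := Nat.le_ceil (x * n)
  have h2 := Nat.ceil_lt_add_one (mul_nonneg hx hn'.le)
  have e : (⌈x * n⌉₊ : ℝ) / n - x = (⌈x * n⌉₊ - x * n) / n := by field_simp
  rw [e, abs_div, abs_of_pos hn']
  exact div_le_div_of_nonneg_right (abs_le.2 ⟨by linarith, by linarith⟩) hn'.le

/-- A positive continuous function on a compact interval is bounded away from zero. -/
lemma exists_pos_forall_le {g : ℝ → ℝ} (hg : Continuous g) (l u : ℝ)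
    (h : ∀ t ∈ Set.Icc l u, 0 < g t) : ∃ η > 0, ∀ t ∈ Set.Icc l u, η ≤ g t := by
  rcases (Set.Icc l u).eq_empty_or_nonempty with he | hne
  · exact ⟨1, one_pos, fun t ht => by rw [he] at ht; exact ht.elim⟩
  · obtain ⟨t, ht, hmin⟩ := isCompact_Icc.exists_isMinOn hne hg.continuousOn
    exact ⟨g t, h t ht, fun s hs => hmin hs⟩

lemma eventually_tail_le_left {a b α m : ℝ} (ha : 0 < a) (hab : a ≤ b) (hb : b ≤ 1 / 2)
    (hα : b - a < α) (hm : m < a) :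
    ∀ᶠ n : ℕ in atTop, ∀ v : ℕ, (v : ℝ) ≤ m * n →
      tail n b (v + 1 + ⌊α * n⌋₊) ≤ tail n a (v + 1) := by
  have hα0 : 0 < α := by linarith
  have ha1 : a ∈ Set.Ioo (0 : ℝ) 1 := ⟨ha, by linarith⟩
  have hb1 : b ∈ Set.Ioo (0 : ℝ) 1 := ⟨by linarith, by linarith⟩
  have hbI : b ∈ Set.Icc (0 : ℝ) 1 := ⟨hb1.1.le, hb1.2.le⟩
  obtain ⟨η, hη, hgap⟩ := exists_pos_forall_le (g := fun t => kl t a - kl (min (t + α) b) b)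
    ((continuous_kl a).sub ((continuous_kl b).comp
      ((continuous_id.add continuous_const).min continuous_const))) 0 m (fun t ht => by
      rcases le_or_gt (t + α) b with h | h
      · have := klGap_neg ha hab hb hα ht.1 (by linarith)
        rw [klGap] at this
        rw [min_eq_left h]
        linarith
      · rw [min_eq_right h.le, kl_self, sub_zero]
        exact kl_pos ha1 ⟨ht.1, by linarith [ht.2]⟩ (by linarith [ht.2]))
  filter_upwards [eventually_exp_le_bin hb1 (half_pos hη),
    eventually_kl_le_of_abs_sub_le b (half_pos hη), eventually_gt_atTop 0] with n h1 h2 hn v hv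
  have hn' : (0 : ℝ) < n := Nat.cast_pos.2 hn
  set r := ⌊α * n⌋₊ with hr
  rcases lt_or_ge n (v + 1 + r) with hlt | hle
  · rw [tail_eq_zero b hlt]; exact tail_nonneg ⟨ha1.1.le, ha1.2.le⟩ n _
  have ht : (v : ℝ) / n ∈ Set.Icc 0 m := ⟨by positivity, (div_le_iff₀ hn').2 hv⟩
  have hta : (v : ℝ) / n ∈ Set.Icc 0 a := ⟨ht.1, ht.2.trans hm.le⟩
  set j := min (v + r) ⌊b * n⌋₊ with hj
  have hjn : j ≤ n := (min_le_left _ _).trans (by omega)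
  have hjI : (j : ℝ) / n ∈ Set.Icc (0 : ℝ) 1 :=
    ⟨by positivity, (div_le_one hn').2 (by exact_mod_cast hjn)⟩
  have hcI : min ((v : ℝ) / n + α) b ∈ Set.Icc (0 : ℝ) 1 :=
    ⟨le_min (by linarith [ht.1]) hb1.1.le, (min_le_right _ _).trans hb1.2.le⟩
  have hdist : |(j : ℝ) / n - min ((v : ℝ) / n + α) b| ≤ 1 / n := by
    have e : (j : ℝ) / n = min ((v : ℝ) / n + (r : ℝ) / n) ((⌊b * n⌋₊ : ℝ) / n) := by
      rw [hj, Nat.cast_min, ← min_div_div_right hn'.le, Nat.cast_add, add_div]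
    rw [e]
    refine (abs_min_sub_min_le_max _ _ _ _).trans (max_le ?_ (abs_floor_div_sub_le hn hb1.1.le))
    rw [add_sub_add_left_eq_sub]
    exact abs_floor_div_sub_le hn hα0.le
  have h3 := h2 _ hjI _ hcI hdist
  have h4 := hgap _ ht
  have h5 : ∑ i ∈ Finset.range (v + 1), bin n a i ≤ bin n b j := by
    refine (sum_range_bin_le_exp ha1 hta (by omega) ?_).trans ((Real.exp_le_exp.2 ?_).trans
      (h1 j hjn))
    · rw [div_mul_cancel₀ _ hn'.ne']; push_cast; exact le_rfl
    · nlinarith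
  have h6 : bin n b j ≤ ∑ i ∈ Finset.range (v + 1 + r), bin n b i :=
    Finset.single_le_sum (fun i _ => bin_nonneg hbI n i)
      (Finset.mem_range.2 (by have := min_le_left (v + r) ⌊b * n⌋₊; omega))
  have h7 := sum_range_bin_add_tail (n := n) (k := v + 1) a (by omega)
  have h8 := sum_range_bin_add_tail (n := n) (k := v + 1 + r) b (by omega)
  linarith

lemma eventually_tail_le_right {a b α m M : ℝ} (ha : a ∈ Set.Ioo (0 : ℝ) 1)
    (hb : b ∈ Set.Ioo (0 : ℝ) 1) (hα : 0 < α) (hm0 : 0 ≤ m) (hm : b - α < m) (hM : M ≤ 1 - α)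
    (hpos : ∀ t ∈ Set.Icc a M, 0 < klGap a b α t) :
    ∀ᶠ n : ℕ in atTop, ∀ v : ℕ, m * n ≤ v → (v : ℝ) ≤ M * n →
      tail n b (v + 1 + ⌊α * n⌋₊) ≤ tail n a (v + 1) := by
  have haI : a ∈ Set.Icc (0 : ℝ) 1 := ⟨ha.1.le, ha.2.le⟩
  obtain ⟨η, hη, hgap⟩ := exists_pos_forall_le (g := fun t => kl (t + α) b - kl (max t a) a)
    (((continuous_kl b).comp (continuous_id.add continuous_const)).sub ((continuous_kl a).comp
      (continuous_id.max continuous_const))) m M (fun t ht => by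
      rcases le_or_gt t a with h | h
      · rw [max_eq_right h, kl_self, sub_zero]
        exact kl_pos hb ⟨by linarith [ht.1], by linarith [ht.2]⟩ (by linarith [ht.1])
      · rw [max_eq_left h.le]
        exact hpos t ⟨h.le, ht.2⟩)
  filter_upwards [eventually_exp_le_bin ha (half_pos hη),
    eventually_kl_le_of_abs_sub_le a (half_pos hη), eventually_gt_atTop 0] with n h1 h2 hn v hv hv'
  have hn' : (0 : ℝ) < n := Nat.cast_pos.2 hn
  have ht : (v : ℝ) / n ∈ Set.Icc m M := ⟨(le_div_iff₀ hn').2 hv, (div_le_iff₀ hn').2 hv'⟩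
  have hvn : v + 1 ≤ n := by
    have h3 : (v : ℝ) < n := by nlinarith
    exact_mod_cast h3
  set i := max (v + 1) ⌈a * n⌉₊ with hi
  have hin : i ≤ n := max_le hvn (Nat.ceil_le.2 (mul_le_of_le_one_left hn'.le ha.2.le))
  have hiI : (i : ℝ) / n ∈ Set.Icc (0 : ℝ) 1 :=
    ⟨by positivity, (div_le_one hn').2 (by exact_mod_cast hin)⟩
  have hcI : max ((v : ℝ) / n) a ∈ Set.Icc (0 : ℝ) 1 :=
    ⟨le_max_of_le_right ha.1.le, max_le (by linarith [ht.2]) ha.2.le⟩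
  have hdist : |(i : ℝ) / n - max ((v : ℝ) / n) a| ≤ 1 / n := by
    have e : (i : ℝ) / n = max ((v : ℝ) / n + 1 / n) ((⌈a * n⌉₊ : ℝ) / n) := by
      rw [hi, Nat.cast_max, ← max_div_div_right hn'.le, Nat.cast_add, add_div, Nat.cast_one]
    rw [e]
    refine (abs_max_sub_max_le_max _ _ _ _).trans (max_le ?_ (abs_ceil_div_sub_le hn ha.1.le))
    rw [add_sub_cancel_left, abs_of_nonneg (by positivity)]
  have h3 := h2 _ hiI _ hcI hdist
  have h4 := hgap _ ht
  refine (tail_le_exp hb (s := (v : ℝ) / n + α) ⟨by linarith [ht.1], by linarith [ht.2]⟩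
    ?_).trans ((Real.exp_le_exp.2 ?_).trans ((h1 i hin).trans
      (bin_le_tail haI (le_max_left _ _) hin)))
  · have := Nat.lt_floor_add_one (α * n)
    rw [add_mul, div_mul_cancel₀ _ hn'.ne']
    push_cast
    linarith
  · nlinarith

lemma eventually_tail_le {a b α M : ℝ} (ha : 0 < a) (hab : a ≤ b) (hb : b ≤ 1 / 2)
    (hα : b - a < α) (hM : M ≤ 1 - α) (hpos : ∀ t ∈ Set.Icc a M, 0 < klGap a b α t) :
    ∀ᶠ n : ℕ in atTop, ∀ v : ℕ, (v : ℝ) ≤ M * n →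
      tail n b (v + 1 + ⌊α * n⌋₊) ≤ tail n a (v + 1) := by
  have hm1 : b - α < max 0 ((b - α + a) / 2) := lt_max_of_lt_right (by linarith)
  have hm2 : max 0 ((b - α + a) / 2) < a := max_lt ha (by linarith)
  filter_upwards [eventually_tail_le_left ha hab hb hα hm2,
    eventually_tail_le_right ⟨ha, by linarith⟩ ⟨by linarith, by linarith⟩ (by linarith)
      (le_max_left _ _) hm1 hM hpos] with n h1 h2 v hv
  rcases le_total (v : ℝ) (max 0 ((b - α + a) / 2) * n) with h | h
  · exact h1 v h
  · exact h2 v h hv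

lemma eventually_G_eq_zero {a b α : ℝ} (ha : 0 < a) (hab : a ≤ b) (hb : b ≤ 1 / 2)
    (hα : b - a < α) (hpos : ∀ t ∈ Set.Icc a (1 - α), 0 < klGap a b α t) :
    ∀ᶠ n : ℕ in atTop, G a b α n = 0 := by
  have haI : a ∈ Set.Icc (0 : ℝ) 1 := ⟨ha.le, by linarith⟩
  filter_upwards [eventually_tail_le ha hab hb hα le_rfl hpos, eventually_gt_atTop 0] with n h1 hn
  refine le_antisymm ((G_le_sum_tail ha.le hab (by linarith) (by linarith) hn).trans_eq
    (Finset.sum_eq_zero fun v _ => ENNReal.ofReal_eq_zero.2 (sub_nonpos.2 ?_))) zero_le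
  rcases le_or_gt (v : ℝ) ((1 - α) * n) with h | h
  · exact h1 v h
  · rw [tail_eq_zero b]
    · exact tail_nonneg haI n _
    · have h2 := Nat.lt_floor_add_one (α * n)
      have h3 : (n : ℝ) < ((v + 1 + ⌊α * n⌋₊ : ℕ) : ℝ) := by push_cast; linarith
      exact_mod_cast h3

lemma eventually_G_le {a b α u ε : ℝ} (ha : 0 < a) (hab : a ≤ b) (hb : b ≤ 1 / 2)
    (hα : b - a < α) (hu : u ∈ Set.Ioc a (1 - α)) (hpos : ∀ t ∈ Set.Ico a u, 0 < klGap a b α t)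
    (hε : 0 < ε) :
    ∀ᶠ n : ℕ in atTop, G a b α n ≤ ENNReal.ofReal (Real.exp (-(n * (kl (u + α) b - ε)))) := by
  have hbo : b ∈ Set.Ioo (0 : ℝ) 1 := ⟨by linarith, by linarith⟩
  have haI : a ∈ Set.Icc (0 : ℝ) 1 := ⟨ha.le, by linarith⟩
  obtain ⟨M, hMa, hMu, hM⟩ : ∃ M, a < M ∧ M < u ∧ kl (u + α) b - ε / 2 < kl (M + α) b := by
    have hc : Tendsto (fun t => kl (t + α) b) (𝓝[<] u) (𝓝 (kl (u + α) b)) :=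
      (((continuous_kl b).comp (continuous_id.add continuous_const)).tendsto u).mono_left
        nhdsWithin_le_nhds
    obtain ⟨M, h1, h2⟩ := ((hc.eventually_const_lt
      (by linarith : kl (u + α) b - ε / 2 < kl (u + α) b)).and
      (Ioo_mem_nhdsLT hu.1)).exists
    exact ⟨M, h2.1, h2.2, h1⟩
  filter_upwards [eventually_tail_le ha hab hb hα (hMu.le.trans hu.2)
    (fun t ht => hpos t ⟨ht.1, ht.2.trans_lt hMu⟩), eventually_gt_atTop 0,
    eventually_natCast_mul_exp_le (half_pos hε)] with n h1 hn h3
  refine (G_le_sum_tail ha.le hab (by linarith) (by linarith) hn).trans ?_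
  have hterm : ∀ v ∈ Finset.range n,
      ENNReal.ofReal (tail n b (v + 1 + ⌊α * n⌋₊) - tail n a (v + 1)) ≤
        ENNReal.ofReal (Real.exp (-(n * kl (M + α) b))) := by
    intro v _
    refine ENNReal.ofReal_le_ofReal ?_
    rcases le_or_gt (v : ℝ) (M * n) with h | h
    · linarith [h1 v h, Real.exp_pos (-(n * kl (M + α) b))]
    · have h2 := Nat.lt_floor_add_one (α * n)
      have h4 := tail_le_exp hbo (s := M + α) ⟨by linarith, by linarith [hu.2]⟩ (n := n)
        (k := v + 1 + ⌊α * n⌋₊) (by push_cast; linarith)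
      linarith [tail_nonneg haI n (v + 1)]
  refine (Finset.sum_le_sum hterm).trans ?_
  rw [Finset.sum_const, Finset.card_range, nsmul_eq_mul, ← ENNReal.ofReal_natCast,
    ← ENNReal.ofReal_mul (Nat.cast_nonneg n)]
  refine ENNReal.ofReal_le_ofReal ((h3 _).trans (Real.exp_le_exp.2 ?_))
  have : (0 : ℝ) ≤ n := Nat.cast_nonneg n
  nlinarith

lemma eventually_le_G_of_crossing {a b α u ε : ℝ} (ha : a ∈ Set.Ioo (0 : ℝ) 1)
    (hb : b ∈ Set.Ioo (0 : ℝ) 1) (hα : 0 < α) (hu : u ∈ Set.Ioo a (1 - α))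
    (hneg : ∀ δ > 0, ∃ t ∈ Set.Ioo u (u + δ), klGap a b α t < 0) (hε : 0 < ε) :
    ∀ᶠ n : ℕ in atTop, ENNReal.ofReal (Real.exp (-(n * (kl (u + α) b + ε)))) ≤ G a b α n := by
  have haI : a ∈ Set.Icc (0 : ℝ) 1 := ⟨ha.1.le, ha.2.le⟩
  have hbI : b ∈ Set.Icc (0 : ℝ) 1 := ⟨hb.1.le, hb.2.le⟩
  obtain ⟨t, hut, ht1, htε, htneg⟩ : ∃ t, u < t ∧ t < 1 - α ∧
      kl (t + α) b < kl (u + α) b + ε / 2 ∧ klGap a b α t < 0 := by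
    have hc : Tendsto (fun t => kl (t + α) b) (𝓝 u) (𝓝 (kl (u + α) b)) :=
      ((continuous_kl b).comp (continuous_id.add continuous_const)).tendsto u
    have hev := hc.eventually_lt_const (by linarith : kl (u + α) b < kl (u + α) b + ε / 2)
    obtain ⟨δ, hδ, h⟩ := Metric.eventually_nhds_iff.1 (hev.and (Iio_mem_nhds hu.2))
    obtain ⟨t, ht, hneg⟩ := hneg δ hδ
    have := @h t (by rw [Real.dist_eq, abs_of_pos (sub_pos.2 ht.1)]; linarith [ht.2])
    exact ⟨t, ht.1, this.2, this.1, hneg⟩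
  rw [klGap] at htneg
  have ht0 : 0 < t := by linarith [ha.1, hu.1]
  set η := min (ε / 4) ((kl t a - kl (t + α) b) / 2) with hη
  have hη0 : 0 < η := lt_min (by linarith) (by linarith)
  have hη1 : η ≤ ε / 4 := min_le_left _ _
  have hη2 : η ≤ (kl t a - kl (t + α) b) / 2 := min_le_right _ _
  have hlim : Tendsto (fun n : ℕ => ((⌈t * n⌉₊ + ⌊α * n⌋₊ : ℕ) : ℝ) / n) atTop (𝓝 (t + α)) := by
    refine ((tendsto_ceil_mul_div ht0.le).add (tendsto_floor_mul_div hα.le)).congr fun n => ?_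
    rw [Nat.cast_add, add_div]
  have hkn : ∀ᶠ n : ℕ in atTop, ⌈t * n⌉₊ + ⌊α * n⌋₊ ≤ n := by
    filter_upwards [hlim.eventually_lt_const (by linarith : t + α < 1), eventually_gt_atTop 0]
      with n h1 hn
    rw [div_lt_one (Nat.cast_pos.2 hn), Nat.cast_lt] at h1
    exact h1.le
  filter_upwards [eventually_exp_le_bin_of_tendsto hb hkn hlim hη0, hkn, eventually_gt_atTop 0,
    eventually_mul_exp_le hη0 2] with n h1 hkn hn h2
  have hn' : (0 : ℝ) < n := Nat.cast_pos.2 hn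
  refine le_trans (ENNReal.ofReal_le_ofReal ?_) (ofReal_tail_sub_le_G haI hbI α hn ⌈t * n⌉₊)
  have h3 := bin_le_tail hbI (le_refl (⌈t * n⌉₊ + ⌊α * n⌋₊)) hkn
  have h4 := tail_le_exp ha (s := t) ⟨by linarith [hu.1], by linarith⟩ (Nat.le_ceil (t * n))
  have h5 := h2 (kl (t + α) b + 2 * η)
  rw [show kl (t + α) b + 2 * η - η = kl (t + α) b + η by ring] at h5
  have h6 : Real.exp (-(n * kl t a)) ≤ Real.exp (-(n * (kl (t + α) b + 2 * η))) :=
    Real.exp_le_exp.2 (by nlinarith)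
  have h7 : Real.exp (-(n * (kl (u + α) b + ε))) ≤ Real.exp (-(n * (kl (t + α) b + 2 * η))) :=
    Real.exp_le_exp.2 (by nlinarith)
  linarith

/-! ### Large thresholds: the tangential case -/

lemma tendsto_sqrt_mul_pre {s : ℝ} (hs : s ∈ Set.Ioo (0 : ℝ) 1) {k : ℕ → ℕ}
    (hk : Tendsto (fun n => (k n : ℝ) / n) atTop (𝓝 s)) :
    Tendsto (fun n : ℕ => √n * pre n (k n)) atTop (𝓝 ((√Real.pi)⁻¹ * (√(2 * (s * (1 - s))))⁻¹)) := by
  have hn : Tendsto (fun n : ℕ => (n : ℝ)) atTop atTop := tendsto_natCast_atTop_atTop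
  have h1s : 0 < 1 - s := sub_pos.2 hs.2
  have hev : ∀ᶠ n : ℕ in atTop, 0 < n ∧ 0 < k n ∧ k n < n := by
    filter_upwards [hk.eventually_const_lt hs.1, hk.eventually_lt_const hs.2,
      eventually_gt_atTop 0] with n h1 h2 h0
    have h0' : (0 : ℝ) < n := Nat.cast_pos.2 h0
    rw [div_lt_one h0', Nat.cast_lt] at h2
    refine ⟨h0, Nat.pos_of_ne_zero fun h => ?_, h2⟩
    rw [h, Nat.cast_zero, zero_div] at h1
    exact lt_irrefl _ h1
  have hk' : Tendsto (fun n => ((n - k n : ℕ) : ℝ) / n) atTop (𝓝 (1 - s)) := by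
    refine (tendsto_const_nhds.sub hk).congr' ?_
    filter_upwards [hev] with n h
    have h0' : (n : ℝ) ≠ 0 := by exact_mod_cast h.1.ne'
    rw [Nat.cast_sub h.2.2.le, sub_div, div_self h0']
  have hinf : ∀ {t : ℝ} {j : ℕ → ℕ}, 0 < t → Tendsto (fun n => (j n : ℝ) / n) atTop (𝓝 t) →
      Tendsto j atTop atTop := by
    intro t j ht hj
    refine tendsto_natCast_atTop_iff.1 ((hj.pos_mul_atTop ht hn).congr' ?_)
    filter_upwards [eventually_gt_atTop 0] with n h
    have h0' : (n : ℝ) ≠ 0 := by exact_mod_cast h.ne'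
    exact div_mul_cancel₀ _ h0'
  have hst := Stirling.tendsto_stirlingSeq_sqrt_pi
  have hpi : √Real.pi ≠ 0 := (Real.sqrt_pos.2 Real.pi_pos).ne'
  have hlim := (hst.div ((hst.comp (hinf hs.1 hk)).mul (hst.comp (hinf h1s hk')))
    (mul_ne_zero hpi hpi)).mul
    (((hk.mul hk').const_mul 2).sqrt.inv₀ (Real.sqrt_pos.2 (by have := hs.1; positivity)).ne')
  have e : √Real.pi / (√Real.pi * √Real.pi) = (√Real.pi)⁻¹ := by field_simp
  rw [e] at hlim
  refine hlim.congr' ?_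
  filter_upwards [hev] with n ⟨h0, h1, h2⟩
  have h0' : (0 : ℝ) < n := Nat.cast_pos.2 h0
  have h1' : (0 : ℝ) < k n := Nat.cast_pos.2 h1
  have h2' : (0 : ℝ) < (n - k n : ℕ) := Nat.cast_pos.2 (by omega)
  have h3 := stirlingSeq_pos h1
  have h4 := stirlingSeq_pos (n := n - k n) (by omega)
  rw [pre_eq h1 h2]
  simp only [Function.comp, Pi.div_apply]
  have e1 : √(2 * ((k n : ℝ) / n * (((n - k n : ℕ) : ℝ) / n))) =
      √(2 * (k n : ℝ)) * √(2 * ((n - k n : ℕ) : ℝ)) / (√n * √(2 * n)) := by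
    rw [← Real.sqrt_mul (by positivity), ← Real.sqrt_mul (by positivity),
      ← Real.sqrt_div (by positivity)]
    congr 1
    field_simp
  rw [e1]
  have h5 : 0 < √(2 * (k n : ℝ)) := by positivity
  have h6 : 0 < √(2 * ((n - k n : ℕ) : ℝ)) := by positivity
  have h7 : 0 < √(n : ℝ) := by positivity
  have h8 : 0 < √(2 * (n : ℝ)) := by positivity
  field_simp

/-- Of two central binomial prefactors, the one further from the middle is larger. -/
lemma eventually_mul_pre_le {s w : ℝ} (hs : s ∈ Set.Ioo (0 : ℝ) 1) (hw : w ∈ Set.Ioo (0 : ℝ) 1)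
    (h : w * (1 - w) < s * (1 - s)) :
    ∃ ρ > 1, ∀ k j : ℕ → ℕ, Tendsto (fun n => (k n : ℝ) / n) atTop (𝓝 s) →
      Tendsto (fun n => (j n : ℝ) / n) atTop (𝓝 w) →
      ∀ᶠ n : ℕ in atTop, ρ * pre n (k n) ≤ pre n (j n) := by
  have hw0 : 0 < w * (1 - w) := mul_pos hw.1 (sub_pos.2 hw.2)
  have hs0 : 0 < s * (1 - s) := hw0.trans h
  have hpi : 0 < (√Real.pi)⁻¹ := inv_pos.2 (Real.sqrt_pos.2 Real.pi_pos)
  set A := (√Real.pi)⁻¹ * (√(2 * (s * (1 - s))))⁻¹ with hA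
  set B := (√Real.pi)⁻¹ * (√(2 * (w * (1 - w))))⁻¹ with hB
  have hA0 : 0 < A := mul_pos hpi (inv_pos.2 (Real.sqrt_pos.2 (by linarith)))
  have hAB : A < B := by
    refine mul_lt_mul_of_pos_left ?_ hpi
    exact inv_strictAnti₀ (Real.sqrt_pos.2 (by linarith))
      (Real.sqrt_lt_sqrt (by linarith) (by linarith))
  obtain ⟨ρ, hρ1, hρ2⟩ := exists_between ((one_lt_div hA0).2 hAB)
  refine ⟨ρ, hρ1, fun k j hk hj => ?_⟩
  rw [lt_div_iff₀ hA0] at hρ2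
  filter_upwards [((tendsto_sqrt_mul_pre hs hk).const_mul ρ).eventually_lt
    (tendsto_sqrt_mul_pre hw hj) hρ2, eventually_gt_atTop 0] with n hn h0
  have h7 : 0 < √(n : ℝ) := Real.sqrt_pos.2 (Nat.cast_pos.2 h0)
  refine le_of_mul_le_mul_left ?_ h7
  linarith

lemma tail_eq_sum_add_tail {n k l : ℕ} (p : ℝ) (h : k + l ≤ n + 1) :
    tail n p k = ∑ i ∈ Finset.range l, bin n p (k + i) + tail n p (k + l) := by
  induction l with
  | zero => simp
  | succ l ih =>
    rw [ih (by omega), Finset.sum_range_succ, tail_eq_add p (by omega : k + l ≤ n)]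
    ring_nf

lemma bin_succ_le {n k : ℕ} {p u : ℝ} (hp : p ∈ Set.Ioo (0 : ℝ) 1) (hu : u ∈ Set.Ioo (0 : ℝ) 1)
    (hk : u * n ≤ k) :
    bin n p (k + 1) ≤ p * (1 - u) / (u * (1 - p)) * bin n p k := by
  have hp1 : 0 < 1 - p := sub_pos.2 hp.2
  have hpI : p ∈ Set.Icc (0 : ℝ) 1 := ⟨hp.1.le, hp.2.le⟩
  rcases lt_or_ge k n with hkn | hkn
  · have hc : (n.choose (k + 1) : ℝ) * (k + 1) = n.choose k * (n - k) := by
      have := Nat.choose_succ_right_eq n k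
      rw [← Nat.cast_sub hkn.le]
      exact_mod_cast this
    have hb0 := bin_nonneg hpI n k
    have e : bin n p (k + 1) * ((k + 1) * (1 - p)) = p * (n - k) * bin n p k := by
      rw [bin, bin, show n - k = n - (k + 1) + 1 by omega, pow_succ, pow_succ]
      linear_combination p ^ k * p * (1 - p) ^ (n - (k + 1)) * (1 - p) * hc
    have hk1 : (0 : ℝ) < (k + 1) * (1 - p) := by positivity
    rw [div_mul_eq_mul_div, le_div_iff₀ (mul_pos hu.1 hp1)]
    refine le_of_mul_le_mul_right ?_ hk1
    calc bin n p (k + 1) * (u * (1 - p)) * ((k + 1) * (1 - p))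
        = p * bin n p k * (1 - p) * (u * (n - k)) := by linear_combination (u * (1 - p)) * e
      _ ≤ p * bin n p k * (1 - p) * ((1 - u) * (k + 1)) := by
          refine mul_le_mul_of_nonneg_left ?_ (by have := hp.1; positivity)
          have := hu.2
          linarith
      _ = p * (1 - u) * bin n p k * ((k + 1) * (1 - p)) := by ring
  · rw [bin_eq_zero p (by omega)]
    have := hp.1
    have := hu.1
    have := sub_pos.2 hu.2
    have := bin_nonneg hpI n k
    positivity

lemma tail_add_le {n k : ℕ} {p u : ℝ} (hp : p ∈ Set.Ioo (0 : ℝ) 1) (hu : u ∈ Set.Ioo (0 : ℝ) 1)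
    (hk : u * n ≤ k) (l : ℕ) :
    tail n p (k + l) ≤ (p * (1 - u) / (u * (1 - p))) ^ l * tail n p k := by
  set θ := p * (1 - u) / (u * (1 - p)) with hθ
  have hθ0 : 0 ≤ θ := div_nonneg (mul_nonneg hp.1.le (sub_nonneg.2 hu.2.le))
    (mul_nonneg hu.1.le (sub_nonneg.2 hp.2.le))
  have hpI : p ∈ Set.Icc (0 : ℝ) 1 := ⟨hp.1.le, hp.2.le⟩
  have hstep : ∀ i : ℕ, k ≤ i → tail n p (i + 1) ≤ θ * tail n p i := by
    intro i hi
    have hki : (k : ℝ) ≤ i := by exact_mod_cast hi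
    rw [tail, ← Finset.sum_Ico_add' (fun j => bin n p j), tail, Finset.mul_sum]
    calc ∑ j ∈ Finset.Ico i n, bin n p (j + 1) ≤ ∑ j ∈ Finset.Ico i n, θ * bin n p j := by
          refine Finset.sum_le_sum fun j hj => bin_succ_le hp hu ?_
          have : (i : ℝ) ≤ j := by exact_mod_cast (Finset.mem_Ico.1 hj).1
          linarith
      _ ≤ _ := Finset.sum_le_sum_of_subset_of_nonneg (Finset.Ico_subset_Ico_right (by omega))
          fun j _ _ => mul_nonneg hθ0 (bin_nonneg hpI n j)
  induction l with
  | zero => simp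
  | succ l ih =>
    calc tail n p (k + l + 1) ≤ θ * tail n p (k + l) := hstep _ (by omega)
      _ ≤ θ * (θ ^ l * tail n p k) := mul_le_mul_of_nonneg_left ih hθ0
      _ = θ ^ (l + 1) * tail n p k := by ring

/-- At a double zero of the gap, the second binomial distribution has locally larger
probabilities, by a constant factor. -/
lemma eventually_mul_bin_le_bin {a b α u : ℝ} (ha : a ∈ Set.Ioo (0 : ℝ) 1)
    (hb : b ∈ Set.Ioo (0 : ℝ) 1) (hα : 0 < α) (hu : u ∈ Set.Ioo 0 (1 - α)) (hub : b < u + α)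
    (h0 : klGap a b α u = 0) (hd : HasDerivAt (klGap a b α) 0 u) (hu2 : 1 - α < 2 * u) :
    ∃ ρ > 1, ∀ l : ℕ, ∀ᶠ n : ℕ in atTop,
      ρ * bin n a (⌈u * n⌉₊ + l) ≤ bin n b (⌈u * n⌉₊ + l + ⌊α * n⌋₊) := by
  have hlt1 := hu.2
  have hu0 := hu.1
  obtain ⟨ρ, hρ, hpre⟩ := eventually_mul_pre_le (s := u) (w := u + α) ⟨hu.1, by linarith⟩
    ⟨by linarith, by linarith⟩ (by nlinarith)
  obtain ⟨ρ', hρ1, hρ2⟩ := exists_between hρ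
  refine ⟨ρ', hρ1, fun l => ?_⟩
  have hρ0 : 0 < ρ' := one_pos.trans hρ1
  have hl : (0 : ℝ) < l + 1 := by positivity
  set c := Real.log (ρ / ρ') / (l + 1) with hc
  have hc0 : 0 < c := div_pos (Real.log_pos ((one_lt_div hρ0).2 hρ2)) hl
  have hkl : Tendsto (fun n : ℕ => ((⌈u * n⌉₊ + l : ℕ) : ℝ) / n) atTop (𝓝 u) := by
    have h := (tendsto_ceil_mul_div hu.1.le).add
      (tendsto_const_nhds (x := (l : ℝ)).div_atTop tendsto_natCast_atTop_atTop)
    rw [add_zero] at h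
    refine h.congr fun n => ?_
    rw [Nat.cast_add, add_div]
  have hjl : Tendsto (fun n : ℕ => ((⌈u * n⌉₊ + l + ⌊α * n⌋₊ : ℕ) : ℝ) / n) atTop
      (𝓝 (u + α)) := by
    refine (hkl.add (tendsto_floor_mul_div hα.le)).congr fun n => ?_
    rw [Nat.cast_add (⌈u * n⌉₊ + l), add_div]
  have ho : ∀ᶠ x in 𝓝 u, |klGap a b α x| ≤ c * |x - u| := by
    have := (hasDerivAt_iff_isLittleO.1 hd).bound hc0
    simpa [h0] using this
  filter_upwards [hpre _ _ hkl hjl, hkl.eventually ho, eventually_gt_atTop 0,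
    hjl.eventually_const_lt hub, hjl.eventually_lt_const (by linarith : u + α < 1),
    hkl.eventually_lt_const hu.2] with n h1 h2 hn h3 h4 h5
  have hn' : (0 : ℝ) < n := Nat.cast_pos.2 hn
  set k := ⌈u * n⌉₊ + l with hk
  set r := ⌊α * n⌋₊ with hr
  have hjn : k + r ≤ n := by
    rw [div_lt_one hn', Nat.cast_lt] at h4; exact h4.le
  rw [bin_eq_pre_mul_exp ha hn (by omega : k ≤ n), bin_eq_pre_mul_exp hb hn hjn]
  have hrn : (r : ℝ) / n ≤ α := (div_le_iff₀ hn').2 (Nat.floor_le (by positivity))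
  have h6 : kl (((k + r : ℕ) : ℝ) / n) b ≤ kl ((k : ℝ) / n + α) b := by
    have e : ((k + r : ℕ) : ℝ) / n = (k : ℝ) / n + (r : ℝ) / n := by rw [Nat.cast_add, add_div]
    exact (kl_strictMonoOn hb).monotoneOn ⟨h3.le, h4.le⟩ ⟨by linarith, by linarith⟩ (by linarith)
  have h7 : n * klGap a b α ((k : ℝ) / n) ≤ Real.log (ρ / ρ') := by
    have h8 : |(k : ℝ) / n - u| ≤ (l + 1) / n := by
      have e : (k : ℝ) / n - u = ((⌈u * n⌉₊ : ℝ) / n - u) + l / n := by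
        rw [hk, Nat.cast_add, add_div]; ring
      rw [e, add_div, add_comm ((l : ℝ) / n)]
      refine (abs_add_le _ _).trans (add_le_add (abs_ceil_div_sub_le hn hu.1.le) ?_)
      rw [abs_of_nonneg (by positivity)]
    calc n * klGap a b α ((k : ℝ) / n) ≤ n * (c * ((l + 1) / n)) :=
          mul_le_mul_of_nonneg_left ((le_abs_self _).trans
            (h2.trans (mul_le_mul_of_nonneg_left h8 hc0.le))) hn'.le
      _ = Real.log (ρ / ρ') := by rw [hc]; field_simp
  have h9 : ρ' * Real.exp (-(n * kl ((k : ℝ) / n) a)) ≤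
      ρ * Real.exp (-(n * kl (((k + r : ℕ) : ℝ) / n) b)) := by
    have e : ρ = ρ' * Real.exp (Real.log (ρ / ρ')) := by
      rw [Real.exp_log (div_pos (hρ0.trans hρ2) hρ0)]; field_simp
    rw [e, mul_assoc, ← Real.exp_add]
    refine mul_le_mul_of_nonneg_left (Real.exp_le_exp.2 ?_) hρ0.le
    rw [klGap] at h7
    nlinarith
  have hpre0 : 0 ≤ pre n k := bin_nonneg ⟨by positivity, (div_le_one hn').2
    (by exact_mod_cast (by omega : k ≤ n))⟩ n k
  calc ρ' * (pre n k * Real.exp (-(n * kl ((k : ℝ) / n) a)))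
      = pre n k * (ρ' * Real.exp (-(n * kl ((k : ℝ) / n) a))) := by ring
    _ ≤ pre n k * (ρ * Real.exp (-(n * kl (((k + r : ℕ) : ℝ) / n) b))) :=
        mul_le_mul_of_nonneg_left h9 hpre0
    _ = ρ * pre n k * Real.exp (-(n * kl (((k + r : ℕ) : ℝ) / n) b)) := by ring
    _ ≤ _ := mul_le_mul_of_nonneg_right h1 (Real.exp_pos _).le

lemma eventually_le_G_of_tangent {a b α u ε : ℝ} (ha : a ∈ Set.Ioo (0 : ℝ) 1)
    (hb : b ∈ Set.Ioo (0 : ℝ) 1) (hα : 0 < α) (hu : u ∈ Set.Ioo a (1 - α)) (hub : b < u + α)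
    (h0 : klGap a b α u = 0) (hd : HasDerivAt (klGap a b α) 0 u) (hu2 : 1 - α < 2 * u)
    (hε : 0 < ε) :
    ∀ᶠ n : ℕ in atTop, ENNReal.ofReal (Real.exp (-(n * (kl (u + α) b + ε)))) ≤ G a b α n := by
  have haI : a ∈ Set.Icc (0 : ℝ) 1 := ⟨ha.1.le, ha.2.le⟩
  have hbI : b ∈ Set.Icc (0 : ℝ) 1 := ⟨hb.1.le, hb.2.le⟩
  have hu0 : 0 < u := ha.1.trans hu.1
  have hu1 : u < 1 := by linarith [hu.2]
  have ha1 : 0 < 1 - a := sub_pos.2 ha.2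
  obtain ⟨ρ, hρ, hbin⟩ := eventually_mul_bin_le_bin ha hb hα ⟨hu0, hu.2⟩ hub h0 hd hu2
  set θ := a * (1 - u) / (u * (1 - a)) with hθ
  have hθ0 : 0 ≤ θ := div_nonneg (mul_nonneg ha.1.le (by linarith)) (mul_pos hu0 ha1).le
  have hθ1 : θ < 1 := by
    rw [hθ, div_lt_one (mul_pos hu0 ha1)]
    linarith [hu.1]
  obtain ⟨L, hL⟩ := exists_pow_lt_of_lt_one (sub_pos.2 (inv_lt_one_of_one_lt₀ hρ)) hθ1
  set c := ρ * (1 - θ ^ L) - 1 with hc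
  have hc0 : 0 < c := by
    have : ρ * ρ⁻¹ < ρ * (1 - θ ^ L) :=
      mul_lt_mul_of_pos_left (by linarith) (one_pos.trans hρ)
    rw [mul_inv_cancel₀ (one_pos.trans hρ).ne'] at this
    linarith
  have hjl : Tendsto (fun n : ℕ => ((⌈u * n⌉₊ + L + ⌊α * n⌋₊ : ℕ) : ℝ) / n) atTop
      (𝓝 (u + α)) := by
    have h := ((tendsto_ceil_mul_div hu0.le).add
      (tendsto_const_nhds (x := (L : ℝ)).div_atTop tendsto_natCast_atTop_atTop)).add
        (tendsto_floor_mul_div hα.le)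
    rw [add_zero] at h
    refine h.congr fun n => ?_
    rw [Nat.cast_add, Nat.cast_add, add_div, add_div]
  have hjn : ∀ᶠ n : ℕ in atTop, ⌈u * n⌉₊ + L + ⌊α * n⌋₊ ≤ n := by
    filter_upwards [hjl.eventually_lt_const (by linarith [hu.2] : u + α < 1),
      eventually_gt_atTop 0] with n h hn
    rw [div_lt_one (Nat.cast_pos.2 hn), Nat.cast_lt] at h
    exact h.le
  have hE : kl (u + α) b = kl u a := by rw [klGap] at h0; linarith
  filter_upwards [(Finset.range L).eventually_all.2 fun l _ => hbin l, hjn, eventually_gt_atTop 0,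
    eventually_exp_le_bin_of_tendsto ha (hjn.mono fun n h => by omega)
      (tendsto_ceil_mul_div hu0.le) (half_pos hε),
    eventually_mul_exp_le (half_pos hε) c⁻¹] with n h1 h2 hn h3 h4
  set k := ⌈u * n⌉₊ with hk
  set r := ⌊α * n⌋₊ with hr
  refine le_trans (ENNReal.ofReal_le_ofReal ?_) (ofReal_tail_sub_le_G haI hbI α hn k)
  have h5 : ρ * ∑ l ∈ Finset.range L, bin n a (k + l) ≤ tail n b (k + r) := by
    rw [tail_eq_sum_add_tail b (l := L) (by omega : k + r + L ≤ n + 1), Finset.mul_sum]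
    refine le_add_of_le_of_nonneg (Finset.sum_le_sum fun l hl => ?_) (tail_nonneg hbI n _)
    rw [add_right_comm k r l]
    exact h1 l hl
  have h6 := tail_eq_sum_add_tail a (by omega : k + L ≤ n + 1)
  have h7 := tail_add_le ha ⟨hu0, hu1⟩ (Nat.le_ceil (u * n)) L
  rw [← hk, ← hθ] at h7
  have h8 : c * tail n a k ≤ tail n b (k + r) - tail n a k := by
    rw [hc]
    nlinarith
  have h9 := bin_le_tail haI (le_refl k) (by omega : k ≤ n)
  have h10 := h4 (kl u a + ε)
  rw [show kl u a + ε - ε / 2 = kl u a + ε / 2 by ring, inv_mul_le_iff₀ hc0] at h10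
  rw [hE]
  calc _ ≤ c * Real.exp (-(n * (kl u a + ε / 2))) := h10
    _ ≤ c * tail n a k := mul_le_mul_of_nonneg_left (h3.trans h9) hc0.le
    _ ≤ _ := h8

/-! ### Large thresholds -/

lemma binKL_eq_iff_klGap_eq_zero {a b α u : ℝ} (ha : a ∈ Set.Ioo (0 : ℝ) 1)
    (hb : b ∈ Set.Ioo (0 : ℝ) 1) (hu : u ∈ Set.Icc (0 : ℝ) 1) (huα : u + α ∈ Set.Icc (0 : ℝ) 1) :
    binKL (u + α) b = binKL u a ↔ klGap a b α u = 0 := by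
  rw [binKL_eq hb huα, binKL_eq ha hu,
    ENNReal.ofReal_eq_ofReal_iff (kl_nonneg hb huα) (kl_nonneg ha hu), klGap, sub_eq_zero]

/-- As `b ≤ 1 / 2`, deviations to the left never contribute. -/
lemma solsA_eq_empty {a b α : ℝ} (ha : 0 < a) (hab : a ≤ b) (hb : b ≤ 1 / 2) (hα : b - a < α) :
    solsA a b α = ∅ := by
  refine Set.eq_empty_of_forall_notMem fun x ⟨hx, hxα, hle, he⟩ => ?_
  rw [binKL_eq_iff_klGap_eq_zero ⟨ha, by linarith⟩ ⟨by linarith, by linarith⟩ hx hxα] at he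
  exact (klGap_neg ha hab hb hα hx.1 hle).ne he

lemma mem_solsB_iff {a b α x : ℝ} (ha : a ∈ Set.Ioo (0 : ℝ) 1) (hb : b ∈ Set.Ioo (0 : ℝ) 1)
    (hα : 0 < α) : x ∈ solsB a b α ↔ x - α ∈ Set.Icc a (1 - α) ∧ klGap a b α (x - α) = 0 := by
  have key : ∀ hx : x ∈ Set.Icc (0 : ℝ) 1, x - α ∈ Set.Icc (0 : ℝ) 1 →
      (binKL x b = binKL (x - α) a ↔ klGap a b α (x - α) = 0) := fun hx hxα => by
    rw [← binKL_eq_iff_klGap_eq_zero ha hb hxα (by rwa [sub_add_cancel]), sub_add_cancel]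
  constructor
  · rintro ⟨hx, hxα, hle, he⟩
    exact ⟨⟨by linarith, by linarith [hx.2]⟩, (key hx hxα).1 he⟩
  · rintro ⟨h, h0⟩
    have hx : x ∈ Set.Icc (0 : ℝ) 1 := ⟨by linarith [h.1, ha.1], by linarith [h.2]⟩
    have hxα : x - α ∈ Set.Icc (0 : ℝ) 1 := ⟨by linarith [h.1, ha.1], by linarith [h.2]⟩
    exact ⟨hx, hxα, by linarith [h.1], (key hx hxα).2 h0⟩

lemma klGap_pos_of_forall_ne {a b α u : ℝ} (hb : b ∈ Set.Ioo (0 : ℝ) 1) (ha : 0 < a)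
    (hα : b - a < α) (hα0 : 0 < α) (hu : u ∈ Set.Icc a (1 - α))
    (h : ∀ t ∈ Set.Icc a u, klGap a b α t ≠ 0) : 0 < klGap a b α u := by
  have hpos : 0 < klGap a b α a := by
    rw [klGap, kl_self, sub_zero]
    exact kl_pos hb ⟨by linarith, by linarith [hu.1, hu.2]⟩ (by linarith)
  by_contra hneg
  obtain ⟨t, ht, h0⟩ := intermediate_value_Icc' hu.1 (continuous_klGap a b α).continuousOn
    ⟨not_lt.1 hneg, hpos.le⟩
  exact h t ht h0

lemma large_threshold {a b α : ℝ} (ha : 0 < a) (hab : a ≤ b) (hb : b ≤ 1 / 2) (hα : b - a < α) :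
    ∃ dB : ℝ≥0∞, ((solsB a b α = ∅ ∧ dB = ∞) ∨
        ∃ x : ℝ, IsLeast (solsB a b α) x ∧ dB = binKL x b) ∧
      Tendsto (fun n : ℕ => rate n (G a b α n)) atTop (𝓝 (dB : EReal)) := by
  have ha1 : a ∈ Set.Ioo (0 : ℝ) 1 := ⟨ha, by linarith⟩
  have hb1 : b ∈ Set.Ioo (0 : ℝ) 1 := ⟨by linarith, by linarith⟩
  have hα0 : 0 < α := by linarith
  set Z := {u | u ∈ Set.Icc a (1 - α) ∧ klGap a b α u = 0} with hZ
  rcases Z.eq_empty_or_nonempty with he | hne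
  · refine ⟨∞, Or.inl ⟨Set.eq_empty_of_forall_notMem fun x hx => ?_, rfl⟩, ?_⟩
    · have : x - α ∈ Z := (mem_solsB_iff ha1 hb1 hα0).1 hx
      rw [he] at this
      exact this
    · have hG := eventually_G_eq_zero ha hab hb hα fun t ht =>
        klGap_pos_of_forall_ne hb1 ha hα hα0 ht fun s hs h0 => by
          have : s ∈ Z := ⟨⟨hs.1, hs.2.trans ht.2⟩, h0⟩
          rw [he] at this
          exact this
      refine tendsto_const_nhds.congr' ?_
      filter_upwards [hG, eventually_gt_atTop 0] with n h hn
      rw [h, rate_zero hn, EReal.coe_ennreal_top]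
  · have hZc : IsCompact Z :=
      isCompact_Icc.inter_right (isClosed_eq (continuous_klGap a b α) continuous_const)
    obtain ⟨u, ⟨hu, h0⟩, hmin⟩ := hZc.exists_isLeast hne
    have hpos : ∀ t ∈ Set.Ico a u, 0 < klGap a b α t := fun t ht =>
      klGap_pos_of_forall_ne hb1 ha hα hα0 ⟨ht.1, ht.2.le.trans hu.2⟩ fun s hs hs0 =>
        (hmin ⟨⟨hs.1, hs.2.trans (ht.2.le.trans hu.2)⟩, hs0⟩).not_gt (hs.2.trans_lt ht.2)
    have hau : a < u := by
      refine lt_of_le_of_ne hu.1 fun h => ?_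
      rw [← h, klGap, kl_self, sub_zero] at h0
      exact (kl_pos hb1 (p := a + α) ⟨by linarith, by linarith [hu.2]⟩ (by linarith)).ne' h0
    have hu1 : u < 1 - α := lt_of_klGap_eq_zero hα0 ha ⟨hau, hu.2⟩ h0 hpos
    have huI : u + α ∈ Set.Icc (0 : ℝ) 1 := ⟨by linarith, by linarith⟩
    refine ⟨binKL (u + α) b, Or.inr ⟨u + α, ⟨?_, fun x hx => ?_⟩, rfl⟩, ?_⟩
    · rw [mem_solsB_iff ha1 hb1 hα0, add_sub_cancel_right]
      exact ⟨hu, h0⟩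
    · have := hmin ((mem_solsB_iff ha1 hb1 hα0).1 hx)
      linarith
    · rw [binKL_eq hb1 huI, EReal.coe_ennreal_ofReal, max_eq_left (kl_nonneg hb1 huI)]
      refine tendsto_rate (fun ε hε => ?_) fun ε hε =>
        eventually_G_le ha hab hb hα ⟨hau, hu.2⟩ hpos hε
      rcases klGap_crossing_or_tangent hα0 ha ⟨hau, hu1⟩ h0 hpos with h | ⟨h, h2⟩
      · exact eventually_le_G_of_crossing ha1 hb1 hα0 ⟨hau, hu1⟩ h hε
      · exact eventually_le_G_of_tangent ha1 hb1 hα0 ⟨hau, hu1⟩ (by linarith) h0 h h2 hε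

end BinaryOT

end

theorem corollary1 (a b α : ℝ) (ha : 0 ≤ a) (hab : a ≤ b) (hb : b ≤ 1 / 2) :
    -- the case `α < b - a`
    (0 ≤ α → α < b - a →
      ∃ v : ℝ≥0∞,
        IsLeast ((fun x => max (BinaryOT.binKL (x + α) b) (BinaryOT.binKL x a)) ''
          {x : ℝ | x ∈ Set.Icc 0 1 ∧ x + α ∈ Set.Icc 0 1}) v ∧
        Tendsto (fun n : ℕ => BinaryOT.rate n (1 - BinaryOT.G a b α n)) atTop (𝓝 (v : EReal)) ∧
        (0 < a →
          ∃ x : ℝ, (x ∈ Set.Icc a (b - α) ∧ BinaryOT.binKL (x + α) b = BinaryOT.binKL x a) ∧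
            (∀ y : ℝ, y ∈ Set.Icc a (b - α) →
              BinaryOT.binKL (y + α) b = BinaryOT.binKL y a → y = x) ∧
            v = BinaryOT.binKL x a)) ∧
    -- the case `α > b - a`
    (0 < a → b - a < α →
      ∃ dA dB : ℝ≥0∞,
        ((BinaryOT.solsA a b α = ∅ ∧ dA = ∞) ∨
          ∃ x : ℝ, IsGreatest (BinaryOT.solsA a b α) x ∧ dA = BinaryOT.binKL x a) ∧
        ((BinaryOT.solsB a b α = ∅ ∧ dB = ∞) ∨
          ∃ x : ℝ, IsLeast (BinaryOT.solsB a b α) x ∧ dB = BinaryOT.binKL x b) ∧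
        Tendsto (fun n : ℕ => BinaryOT.rate n (BinaryOT.G a b α n)) atTop
          (𝓝 ((min dA dB : ℝ≥0∞) : EReal))) := by
  refine ⟨fun hα h => BinaryOT.small_threshold ha (by linarith) hα h, fun ha0 h => ?_⟩
  obtain ⟨dB, hdB, hlim⟩ := BinaryOT.large_threshold ha0 hab hb h
  refine ⟨∞, dB, Or.inl ⟨BinaryOT.solsA_eq_empty ha0 hab hb h, rfl⟩, hdB, ?_⟩
  rwa [min_eq_right le_top]
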